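/- All alphabets $\mathcal X,\mathcal Y,\mathcal U,\mathcal V$ are finite and logarithms are to base 2. For a pair $(X,Y)$ with joint p.m.f. $p_{XY}$ on $\mathcal X\times\mathcal Y$, the region of tension is $$\mathfrak R(X;Y)=\{s\in\mathbb R_+^3:\ s\ge (I(Y;Q|X),\,I(X;Q|Y),\,I(X;Y|Q))\ \text{for some finite random variable } Q \text{ jointly distributed with } (X,Y)\},$$ where $\ge$ is coordinatewise. A two-party protocol $\Pi$ with set up $(X,Y)$ gives $X$ to Alice and $Y$ to Bob. Starting with Alice, the parties alternate turns. At its turn, a party that has not terminated applies a (discrete) randomized function to its current view, and either moves to a new local state and sends a message to the other party, or terminates with an output; a party that has terminated does nothing at its turns. Communication is noiseless and unlimited. The view of a party consists of its part of the set up, all its local states, all messages it has sent and received (in order), and its output. The protocol is valid if with probability $1$ both parties terminate after finitely many turns; then $\Pi_A^{\rm view},\Pi_B^{\rm view}$ denote the final views and $\Pi_A^{\rm out},\Pi_B^{\rm out}$ the outputs. For $\epsilon\ge 0$, $\Pi$ $\epsilon$-securely samples $(U,V)$ from the set up $(X,Y)$ (against honest-but-curious parties) if $\Pi$ is valid and there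 are simulated views $\Sigma_A,\Sigma_B$, given by conditional laws $p_{\Sigma_A|U,V}$ and $p_{\Sigma_B|U,V}$ over the sets of possible views of Alice and of Bob, such that $\Sigma_A - U - V$ and $U - V - \Sigma_B$ are Markov chains and $$\Delta\big((U,V),(\Pi_A^{\rm out},\Pi_B^{\rm out})\big)\le\epsilon,\quad \Delta\big((\Sigma_A,V),(\Pi_A^{\rm view},\Pi_B^{\rm out})\big)\le\epsilon,\quad \Delta\big((U,\Sigma_B),(\Pi_A^{\rm out},\Pi_B^{\rm view})\big)\le\epsilon,$$ where $\Delta$ is the total variation distance. Writing $(X^n,Y^n)$ for $n$ independent copies of $(X,Y)$, the rate of statistically securely sampling $(U,V)$ from $(X,Y)$ is $$\rho=\lim_{\epsilon\downarrow0}\ \sup\Big\{\tfrac{n_1}{n_2}:\ n_1,n_2\ge1,\ \text{some protocol } \epsilon\text{-securely samples } (U^{n_1},V^{n_1}) \text{ from the set up } (X^{n_2},Y^{n_2})\Big\}\in[0,\infty],$$ where $\sup\emptyset=0$. **Theorem.** For every real $r$ with $0<r\le\rho$ (in particular for $r=\rho$ if $0<\rho<\infty$), $$\mathfrak R(X;Y)\subseteq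 r\cdot\mathfrak R(U;V)=\{r\,a: a\in\mathfrak R(U;V)\}.$$ -/

import Mathlib

open Filter Topology
open scoped ENNReal Pointwise

namespace SecureSampling

noncomputable section

/-! ### Information measures (logarithms to base 2) -/

/-- Shannon entropy, in bits, of a p.m.f. on a finite alphabet. -/
def entropy {α : Type*} [Fintype α] (p : PMF α) : ℝ :=
  ∑ a, Real.negMulLog (p a).toReal / Real.log 2

/-- Conditional mutual information `I(A;B|C) = H(AC) + H(BC) - H(ABC) - H(C)` of random variables
`A`, `B`, `C` with finite alphabets on a discrete probability space `(Ω, μ)`. -/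
def condMutualInfo {Ω α β γ : Type*} [Fintype α] [Fintype β] [Fintype γ]
    (μ : PMF Ω) (A : Ω → α) (B : Ω → β) (C : Ω → γ) : ℝ :=
  entropy (μ.map fun ω => (A ω, C ω)) + entropy (μ.map fun ω => (B ω, C ω))
    - entropy (μ.map fun ω => (A ω, B ω, C ω)) - entropy (μ.map C)

/-- Total variation distance `½ ‖p - q‖₁`. -/
def tvDist {α : Type*} (p q : PMF α) : ℝ :=
  (∑' a, |(p a).toReal - (q a).toReal|) / 2

/-- A triple with law `μ` is a Markov chain `A - B - C`:
`p(a,b,c) p(b) = p(a,b) p(b,c)` for all `a, b, c`. -/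
def IsMarkov {α β γ : Type*} (μ : PMF (α × β × γ)) : Prop :=
  ∀ a b c, μ (a, b, c) * (μ.map fun t => t.2.1) b
    = (μ.map fun t => (t.1, t.2.1)) (a, b) * (μ.map fun t => t.2) (b, c)

/-! ### The region of tension -/

/-- The joint law of `(X, Y, Q)` when `(X, Y)` has law `P` and `Q` has conditional law `K`. -/
def jointLaw {X Y Q : Type*} (P : PMF (X × Y)) (K : X × Y → PMF Q) : PMF (X × Y × Q) :=
  P.bind fun w => (K w).map fun q => (w.1, w.2, q)

/-- The tension `(I(Y;Q|X), I(X;Q|Y), I(X;Y|Q))` of `(X, Y)` given `Q`. -/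
def tension {X Y Q : Type*} [Fintype X] [Fintype Y] [Fintype Q]
    (P : PMF (X × Y)) (K : X × Y → PMF Q) : ℝ × ℝ × ℝ :=
  (condMutualInfo (jointLaw P K) (fun t => t.2.1) (fun t => t.2.2) (fun t => t.1),
   condMutualInfo (jointLaw P K) (fun t => t.1) (fun t => t.2.2) (fun t => t.2.1),
   condMutualInfo (jointLaw P K) (fun t => t.1) (fun t => t.2.1) (fun t => t.2.2))

/-- The increasing hull in the nonnegative orthant (the order is coordinatewise). -/
def increasingHull (S : Set (ℝ × ℝ × ℝ)) : Set (ℝ × ℝ × ℝ) :=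
  {s | 0 ≤ s ∧ ∃ s' ∈ S, s' ≤ s}

/-- The region of tension of a pair with law `P`: the increasing hull of the set of all tensions
given a finite random variable `Q` jointly distributed with the pair. -/
def tensionRegion {X Y : Type*} [Fintype X] [Fintype Y] (P : PMF (X × Y)) : Set (ℝ × ℝ × ℝ) :=
  increasingHull {t | ∃ (k : ℕ) (K : X × Y → PMF (Fin k)), t = tension P K}

/-! ### Two-party protocols -/

/-- An entry in the record that a party keeps of an execution. -/
inductive Event (S M : Type*) where
  /-- The party moved to the new local state `s` and sent the message `m`. -/
  | sent (s : S) (m : M)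
  /-- The party received the message `m`. -/
  | received (m : M)

/-- What a party has seen so far: its part of the set up, all its local states and all messages
sent and received (latest first), and its output once it has terminated. -/
structure View (I S M O : Type*) where
  setup : I
  history : List (Event S M)
  output : Option O

/-- A two-party protocol with unlimited communication; Alice gets an element of `X` and Bob an
element of `Y` as set up, and they output elements of `U` and `V`. When it is its turn, a party
applies a randomized function to what it knows; the result is either a new local state together
with a message to the other party, or termination with an output.
Functions of the last local state and of the messages received since are a special case. -/
structure Protocol (X Y U V : Type*) where
  /-- Local states of Alice. -/
  SA : Type
  /-- Local states of Bob. -/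
  SB : Type
  /-- Messages. -/
  M : Type
  alice : View X SA M U → PMF ((SA × M) ⊕ U)
  bob : View Y SB M V → PMF ((SB × M) ⊕ V)

namespace Protocol

variable {X Y U V : Type*} (π : Protocol X Y U V)

abbrev ViewA : Type _ := View X π.SA π.M U

abbrev ViewB : Type _ := View Y π.SB π.M V

/-- A pair of views. -/
abbrev Config : Type _ := π.ViewA × π.ViewB

/-- A turn of Alice; a party that has terminated does nothing. -/
def aliceTurn (c : π.Config) : PMF π.Config :=
  match c.1.output with
  | some _ => PMF.pure c
  | none => (π.alice c.1).map fun
      | .inl (s, m) =>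
          ({ c.1 with history := .sent s m :: c.1.history },
           { c.2 with history := .received m :: c.2.history })
      | .inr u => ({ c.1 with output := some u }, c.2)

/-- A turn of Bob; a party that has terminated does nothing. -/
def bobTurn (c : π.Config) : PMF π.Config :=
  match c.2.output with
  | some _ => PMF.pure c
  | none => (π.bob c.2).map fun
      | .inl (s, m) =>
          ({ c.1 with history := .received m :: c.1.history },
           { c.2 with history := .sent s m :: c.2.history })
      | .inr v => (c.1, { c.2 with output := some v })

/-- The law of the two views after `n` turns, the set up having law `P`; the parties take turns,
and Alice begins. -/
def run (P : PMF (X × Y)) : ℕ → PMF π.Config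
  | 0 => P.map fun w => (⟨w.1, [], none⟩, ⟨w.2, [], none⟩)
  | n + 1 => (run P n).bind (if Even n then π.aliceTurn else π.bobTurn)

/-- Both parties have terminated. -/
def Terminated (c : π.Config) : Prop :=
  c.1.output.isSome ∧ c.2.output.isSome

/-- The probability that the views after `n` turns are `c` and both parties have terminated. -/
def doneMass (P : PMF (X × Y)) (n : ℕ) (c : π.Config) : ℝ≥0∞ :=
  {c | π.Terminated c}.indicator (π.run P n) c

/-- The protocol is valid: with probability one both parties terminate after finitely many turns,
that is, the probability that they have terminated within `n` turns tends to one. -/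
def Valid (P : PMF (X × Y)) : Prop :=
  Tendsto (fun n => ∑' c, π.doneMass P n c) atTop (𝓝 1)

/-- The probability that the execution ends with the pair of views `c`. -/
def finalMass (P : PMF (X × Y)) (c : π.Config) : ℝ≥0∞ :=
  ⨆ n, π.doneMass P n c

theorem doneMass_mono (P : PMF (X × Y)) : Monotone (π.doneMass P) := by
  refine monotone_nat_of_le_succ fun n c => ?_
  unfold doneMass
  by_cases hc : π.Terminated c
  · rw [Set.indicator_of_mem (by exact hc), Set.indicator_of_mem (by exact hc)]
    have key : (if Even n then π.aliceTurn else π.bobTurn) c = PMF.pure c := by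
      obtain ⟨⟨x, h, o⟩, ⟨y, h', o'⟩⟩ := c
      obtain ⟨h1, h2⟩ := hc
      obtain ⟨u, rfl⟩ := Option.isSome_iff_exists.1 h1
      obtain ⟨v, rfl⟩ := Option.isSome_iff_exists.1 h2
      split_ifs <;> rfl
    have : π.run P (n + 1) = (π.run P n).bind (if Even n then π.aliceTurn else π.bobTurn) := rfl
    rw [this, PMF.bind_apply]
    refine le_trans ?_ (ENNReal.le_tsum c)
    rw [key]; simp
  · rw [Set.indicator_of_notMem (by exact hc)]; exact bot_le

theorem hasSum_finalMass {P : PMF (X × Y)} (h : π.Valid P) : HasSum (π.finalMass P) 1 := by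
  have hs : ∑' c, π.finalMass P c = ⨆ n, ∑' c, π.doneMass P n c := by
    let _ : MeasurableSpace π.Config := ⊤
    simp only [← MeasureTheory.lintegral_count, finalMass]
    exact MeasureTheory.lintegral_iSup (fun n => measurable_from_top) (π.doneMass_mono P)
  have ht : Tendsto (fun n => ∑' c, π.doneMass P n c) atTop
      (𝓝 (⨆ n, ∑' c, π.doneMass P n c)) :=
    tendsto_atTop_iSup fun m n hmn => ENNReal.tsum_le_tsum fun c => π.doneMass_mono P hmn c
  have := ENNReal.summable.hasSum (f := π.finalMass P)
  rwa [hs, tendsto_nhds_unique ht h] at this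

/-- The joint law of the final views of a valid protocol. -/
def finalLaw {P : PMF (X × Y)} (h : π.Valid P) : PMF π.Config :=
  ⟨π.finalMass P, π.hasSum_finalMass h⟩

/-- The protocol `ε`-securely samples a pair with law `R` from a set up with law `P`: it is valid,
and there are simulated views `σA` of Alice and `σB` of Bob, given by conditional laws given
`(U, V)`, with `σA - U - V` and `U - V - σB`, such that the three pairs
`(U, V)`, `(σA, V)`, `(U, σB)` are `ε`-close in total variation to
`(outA, outB)`, `(viewA, outB)`, `(outA, viewB)`. -/
def SecurelySamples (ε : ℝ) (P : PMF (X × Y)) (R : PMF (U × V)) : Prop :=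
  ∃ (h : π.Valid P) (σA : U × V → PMF π.ViewA) (σB : U × V → PMF π.ViewB),
    let simA : PMF (π.ViewA × U × V) := R.bind fun w => (σA w).map fun s => (s, w.1, w.2)
    let simB : PMF (U × V × π.ViewB) := R.bind fun w => (σB w).map fun s => (w.1, w.2, s)
    IsMarkov simA ∧ IsMarkov simB ∧
    tvDist (R.map fun w => (some w.1, some w.2))
      ((π.finalLaw h).map fun c => (c.1.output, c.2.output)) ≤ ε ∧
    tvDist (simA.map fun t => (t.1, some t.2.2))
      ((π.finalLaw h).map fun c => (c.1, c.2.output)) ≤ ε ∧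
    tvDist (simB.map fun t => (some t.1, t.2.2))
      ((π.finalLaw h).map fun c => (c.1.output, c.2)) ≤ ε

end Protocol

/-! ### The rate of statistically secure sampling -/

/-- The law of `n` independent copies `(Xⁿ, Yⁿ)` of a pair with law `P`. -/
def iid {X Y : Type*} [Fintype X] [Fintype Y] (P : PMF (X × Y)) (n : ℕ) :
    PMF ((Fin n → X) × (Fin n → Y)) :=
  PMF.ofFintype (fun w => ∏ i, P (w.1 i, w.2 i)) (by
    classical
    have h1 : ∑ w : X × Y, P w = 1 := (tsum_fintype (fun w => P w)).symm.trans P.tsum_coe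
    have h2 := Finset.prod_univ_sum (fun _ : Fin n => (Finset.univ : Finset (X × Y)))
      (fun _ w => P w)
    simp only [h1, Finset.prod_const_one, Fintype.piFinset_univ] at h2
    rw [h2]
    exact (Equiv.sum_comp (Equiv.arrowProdEquivProdArrow (Fin n) (fun _ => X) (fun _ => Y))
      (fun w => ∏ i, P (w.1 i, w.2 i))).symm)

/-- The supremum of `n₁ / n₂` over all `n₁, n₂ ≥ 1` such that some protocol `ε`-securely samples
`n₁` independent copies of `(U, V)` from `n₂` independent copies of `(X, Y)`. -/
def supRatio {X Y U V : Type*} [Fintype X] [Fintype Y] [Fintype U] [Fintype V]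
    (P : PMF (X × Y)) (R : PMF (U × V)) (ε : ℝ) : ℝ≥0∞ :=
  sSup {q | ∃ n₁ n₂ : ℕ, 0 < n₁ ∧ 0 < n₂ ∧
    (∃ π : Protocol (Fin n₂ → X) (Fin n₂ → Y) (Fin n₁ → U) (Fin n₁ → V),
      π.SecurelySamples ε (iid P n₂) (iid R n₁)) ∧ q = (n₁ : ℝ≥0∞) / n₂}

/-- The rate of statistically securely sampling a pair with law `R` from a set up with law `P`:
the limit, in `[0, ∞]`, of `supRatio P R ε` as `ε` decreases to `0`. -/
def statRate {X Y U V : Type*} [Fintype X] [Fintype Y] [Fintype U] [Fintype V]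
    (P : PMF (X × Y)) (R : PMF (U × V)) : ℝ≥0∞ :=
  limUnder (𝓝[>] (0 : ℝ)) (supRatio P R)

/-- The limit that defines the rate always exists. -/
theorem tendsto_supRatio {X Y U V : Type*} [Fintype X] [Fintype Y] [Fintype U] [Fintype V]
    (P : PMF (X × Y)) (R : PMF (U × V)) :
    Tendsto (supRatio P R) (𝓝[>] (0 : ℝ)) (𝓝 (statRate P R)) := by
  have hm : Monotone (supRatio P R) := by
    intro ε ε' h
    refine sSup_le_sSup ?_
    rintro q ⟨n₁, n₂, h₁, h₂, ⟨π, hv, σA, σB, hA, hB, a, b, c⟩, rfl⟩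
    exact ⟨n₁, n₂, h₁, h₂, ⟨π, hv, σA, σB, hA, hB, a.trans h, b.trans h, c.trans h⟩, rfl⟩
  exact tendsto_nhds_limUnder ⟨_, hm.tendsto_nhdsGT 0⟩

end

end SecureSampling

/-! Let `T` be the transcript of a protocol run on a set up `(X, Y)` with side information `Q`. The
idea is that `(Q, T)`, as side information about the two outputs, has hardly more tension than `Q`
has about `(X, Y)`.

Given the set up and `Q`, the law of `T` and the two views is a product of one factor per party
(`Protocol.tracedRun_apply`), and every Markov chain below comes from this product. Each message is
computed by one party alone, so `I(X;Y|Q,T)` never grows, and the outputs `A`, `B` are then computed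
locally; hence `I(A;B|Q,T) ≤ I(X;Y|Q)` (`Protocol.outputInfo_le`). The other two coordinates need
security. The simulated view of Alice is independent of `V` given `U`, so `H(V|U)` is at most about
`H(B|view of Alice)`. The transcript is a function of that view, so passing from the view to `(A, Q,
T)` lowers the entropy of `B` by at most `I(Y;Q|X)` (`Protocol.leakA_le`, and `Protocol.leakB_le`
for Bob).

The ideal and the real laws are compared by the bound of Alicki, Fannes and Winter
(`condEntropy_le_add_entropyModulus`). Its error depends on the alphabet of the entropy's argument
but not on that of the condition, so views and transcripts may be unbounded. For `n₁` copies of `(U,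
V)` the error is at most linear in `n₁`; per copy it tends to zero with `ε`, uniformly in `n₁`.

Using `Q` independently on `n₂` copies multiplies the tension by `n₂`; conversely, the tension of
`n₁` copies dominates `n₁` times a tension of one copy, because tensions are superadditive and form
a convex set (`exists_natTensions_smul_le`). The tension is a sum, over the values of the side
information, of a homogeneous continuous functional of the unnormalised conditional law. The set of
tensions is therefore a slice of the convex hull of a compact graph. So it is compact, it contains
the tensions of infinite side information, and its points come from finite `Q`. Compactness lets `ε
→ 0` and the ratio tend to `r` itself. -/

namespace SecureSampling

noncomputable section

/-! ### Entropy of finite mass functions -/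

/-- The entropy, in nats, of a finite mass function, scaled by the total mass: `S · H(v / S)` with
`S = ∑ v`. -/
def massEntropy {α : Type*} [Fintype α] (v : α → ℝ) : ℝ :=
  ∑ a, Real.negMulLog (v a) - Real.negMulLog (∑ a, v a)

section massEntropy

variable {α β ι : Type*} [Fintype α] [Fintype β]

@[simp] theorem massEntropy_zero : massEntropy (fun _ : α => (0 : ℝ)) = 0 := by
  simp [massEntropy]

/-- The terms with `negMulLog c` cancel between the sum and the total. This homogeneity allows
conditional entropies to be computed without normalising. -/
theorem massEntropy_mul_left (c : ℝ) (v : α → ℝ) :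
    massEntropy (fun a => c * v a) = c * massEntropy v := by
  unfold massEntropy
  rw [← Finset.mul_sum]
  simp only [Real.negMulLog_mul, Finset.sum_add_distrib, ← Finset.mul_sum, ← Finset.sum_mul]
  ring

theorem massEntropy_mul_right (c : ℝ) (v : α → ℝ) :
    massEntropy (fun a => v a * c) = massEntropy v * c := by
  simp only [mul_comm _ c, massEntropy_mul_left]

theorem continuous_massEntropy : Continuous (massEntropy : (α → ℝ) → ℝ) := by
  unfold massEntropy
  fun_prop

theorem massEntropy_comp_equiv (e : β ≃ α) (v : α → ℝ) :
    massEntropy (fun b => v (e b)) = massEntropy v := by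
  unfold massEntropy
  rw [e.sum_comp v, e.sum_comp fun a => Real.negMulLog (v a)]

theorem massEntropy_eq_sum_log {v : α → ℝ} (hv : ∀ a, 0 ≤ v a) :
    massEntropy v = ∑ a, v a * -Real.log (v a / ∑ b, v b) := by
  by_cases hS : ∑ b, v b = 0
  · have := (Finset.sum_eq_zero_iff_of_nonneg fun a _ => hv a).1 hS
    simp only [Finset.mem_univ, true_imp_iff] at this
    simp [massEntropy, this]
  · have : ∀ a, v a * -Real.log (v a / ∑ b, v b)
        = Real.negMulLog (v a) + v a * Real.log (∑ b, v b) := by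
      intro a
      by_cases ha : v a = 0
      · simp [ha]
      · rw [Real.log_div ha hS, Real.negMulLog]; ring
    simp only [this, Finset.sum_add_distrib, ← Finset.sum_mul, massEntropy]
    rw [Real.negMulLog]; ring

/-- Gibbs' inequality. -/
theorem massEntropy_le_cross {v w : α → ℝ} (hv : ∀ a, 0 ≤ v a) (hw : ∀ a, 0 ≤ w a)
    (hw1 : ∑ a, w a ≤ 1) (h : ∀ a, w a = 0 → v a = 0) :
    massEntropy v ≤ ∑ a, v a * -Real.log (w a) := by
  set S := ∑ b, v b with hS
  have hS0 : 0 ≤ S := Finset.sum_nonneg fun a _ => hv a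
  -- This is `log x ≤ x - 1` at `x = w a * S / v a`. The corrections `w a * S - v a` sum to `(∑ w -
  -- 1) * S ≤ 0`.
  have key : ∀ a, v a * -Real.log (v a / S) ≤ v a * -Real.log (w a) + (w a * S - v a) := by
    intro a
    rcases (hv a).eq_or_lt with h0 | h0
    · rw [← h0]; simpa using mul_nonneg (hw a) hS0
    · have hSp : 0 < S :=
        lt_of_lt_of_le h0 (Finset.single_le_sum (fun b _ => hv b) (Finset.mem_univ a))
      have hwp : 0 < w a := lt_of_le_of_ne (hw a) fun h' => h0.ne' (h a h'.symm)
      have h1 := Real.log_le_sub_one_of_pos (show 0 < w a * S / v a by positivity)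
      rw [Real.log_div (by positivity) h0.ne', Real.log_mul hwp.ne' hSp.ne'] at h1
      rw [Real.log_div h0.ne' hSp.ne']
      have h2 := mul_le_mul_of_nonneg_left h1 h0.le
      have h3 : v a * (w a * S / v a - 1) = w a * S - v a := by field_simp
      rw [h3] at h2
      linarith
  rw [massEntropy_eq_sum_log hv]
  refine (Finset.sum_le_sum fun a _ => key a).trans ?_
  rw [Finset.sum_add_distrib, Finset.sum_sub_distrib, ← Finset.sum_mul, ← hS]
  nlinarith

theorem massEntropy_nonneg {v : α → ℝ} (hv : ∀ a, 0 ≤ v a) : 0 ≤ massEntropy v := by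
  rw [massEntropy_eq_sum_log hv]
  refine Finset.sum_nonneg fun a _ => mul_nonneg (hv a) ?_
  have h0 : 0 ≤ ∑ b, v b := Finset.sum_nonneg fun a _ => hv a
  exact neg_nonneg.2 (Real.log_nonpos (div_nonneg (hv a) h0)
    (div_le_one_of_le₀ (Finset.single_le_sum (fun b _ => hv b) (Finset.mem_univ a)) h0))

/-- Gibbs' inequality against the uniform law. -/
theorem massEntropy_le_mul_log_card {v : α → ℝ} (hv : ∀ a, 0 ≤ v a) :
    massEntropy v ≤ (∑ a, v a) * Real.log (Fintype.card α) := by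
  rcases isEmpty_or_nonempty α with h | h
  · simp [massEntropy]
  · have hc : (0 : ℝ) < Fintype.card α := by exact_mod_cast Fintype.card_pos
    have := massEntropy_le_cross (w := fun _ => (Fintype.card α : ℝ)⁻¹) hv
      (fun _ => by positivity) (by simp [hc.ne'])
      (fun a ha => absurd ha (by positivity))
    simpa [← Finset.sum_mul] using this

/-- Countable superadditivity of the entropy of mass functions. -/
theorem tsum_massEntropy_le {v : ι → α → ℝ} {V : α → ℝ} (hv : ∀ z a, 0 ≤ v z a)
    (hV : ∀ a, HasSum (fun z => v z a) (V a)) :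
    Summable (fun z => massEntropy (v z)) ∧ ∑' z, massEntropy (v z) ≤ massEntropy V := by
  have hV0 : ∀ a, 0 ≤ V a := fun a => (hV a).nonneg fun z => hv z a
  have hS0 : 0 ≤ ∑ b, V b := Finset.sum_nonneg fun a _ => hV0 a
  have hle : ∀ z a, v z a ≤ V a := fun z a => le_hasSum (hV a) z fun z' _ => hv z' a
  -- The cross entropy with the normalised total is linear in the mass, so it splits over `z`.
  -- Gibbs' inequality bounds the entropy of each `v z` by its share.
  have hsum : HasSum (fun z => ∑ a, v z a * -Real.log (V a / ∑ b, V b)) (massEntropy V) := by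
    rw [massEntropy_eq_sum_log hV0]
    exact hasSum_sum fun a _ => (hV a).mul_right _
  have hb : ∀ z, massEntropy (v z) ≤ ∑ a, v z a * -Real.log (V a / ∑ b, V b) := by
    intro z
    refine massEntropy_le_cross (hv z) (fun a => div_nonneg (hV0 a) hS0) ?_ ?_
    · rw [← Finset.sum_div]; exact div_self_le_one _
    · intro a ha
      rcases div_eq_zero_iff.1 ha with h | h
      · exact le_antisymm ((hle z a).trans h.le) (hv z a)
      · have := (Finset.sum_eq_zero_iff_of_nonneg fun a _ => hV0 a).1 h a (Finset.mem_univ a)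
        exact le_antisymm ((hle z a).trans this.le) (hv z a)
  have hs : Summable fun z => massEntropy (v z) :=
    hsum.summable.of_nonneg_of_le (fun z => massEntropy_nonneg (hv z)) hb
  exact ⟨hs, (hs.tsum_le_tsum hb hsum.summable).trans hsum.tsum_eq.le⟩

theorem massEntropy_add_le_add {v w : α → ℝ} (hv : ∀ a, 0 ≤ v a) (hw : ∀ a, 0 ≤ w a) :
    massEntropy v + massEntropy w ≤ massEntropy (fun a => v a + w a) := by
  have h := (tsum_massEntropy_le (v := fun b : Bool => if b then v else w)
    (V := fun a => v a + w a) (by rintro (_ | _) a <;> simp [hv, hw])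
    (fun a => by
      have := hasSum_fintype fun b : Bool => (if b then v else w) a
      simpa using this)).2
  simpa using h

theorem negMulLog_add_le {x y : ℝ} (hx : 0 ≤ x) (hy : 0 ≤ y) :
    Real.negMulLog (x + y) ≤ Real.negMulLog x + Real.negMulLog y := by
  have := massEntropy_nonneg (v := fun b : Bool => if b then x else y)
    (by rintro (_ | _) <;> simp [hx, hy])
  simp [massEntropy] at this
  linarith

/-- The excess is at most the entropy of the bit telling which summand was drawn: `negMulLog` is
subadditive on nonnegative reals, and the bit accounts for the totals. -/
theorem massEntropy_add_le {v w : α → ℝ} (hv : ∀ a, 0 ≤ v a) (hw : ∀ a, 0 ≤ w a) :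
    massEntropy (fun a => v a + w a) ≤ massEntropy v + massEntropy w
      + massEntropy (fun b : Bool => if b then ∑ a, v a else ∑ a, w a) := by
  have h : ∑ a, Real.negMulLog (v a + w a)
      ≤ ∑ a, Real.negMulLog (v a) + ∑ a, Real.negMulLog (w a) := by
    rw [← Finset.sum_add_distrib]
    exact Finset.sum_le_sum fun a _ => negMulLog_add_le (hv a) (hw a)
  simp only [massEntropy, Fintype.sum_bool, if_true, Bool.false_eq_true, if_false,
    Finset.sum_add_distrib]
  linarith

/-- The chain rule for mass functions. -/
theorem massEntropy_prod (v : α × β → ℝ) :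
    massEntropy v = massEntropy (fun b => ∑ a, v (a, b))
      + ∑ b, massEntropy fun a => v (a, b) := by
  simp only [massEntropy, Fintype.sum_prod_type_right, Finset.sum_sub_distrib]
  ring

end massEntropy

/-! ### Marginals -/

section marginals

variable {Ω α β γ ζ ζ' : Type*}

theorem map_apply_of_injective (p : PMF Ω) {f : Ω → β} (hf : f.Injective) (ω : Ω) :
    p.map f (f ω) = p ω := by
  classical
  rw [PMF.map_apply, tsum_eq_single ω]
  · simp
  · intro ω' h; rw [if_neg fun h' => h (hf h').symm]

theorem map_congr_support (p : PMF Ω) {f g : Ω → β} (h : ∀ ω ∈ p.support, f ω = g ω) :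
    p.map f = p.map g := by
  classical
  ext b
  rw [PMF.map_apply, PMF.map_apply]
  refine tsum_congr fun ω => ?_
  by_cases hω : p ω = 0
  · simp [hω]
  · rw [h ω ((PMF.mem_support_iff _ _).2 hω)]

theorem hasSum_toReal (p : PMF Ω) : HasSum (fun ω => (p ω).toReal) 1 := by
  have := ENNReal.hasSum_toReal (f := p) p.tsum_coe_ne_top
  rw [← ENNReal.tsum_toReal_eq fun ω => p.apply_ne_top ω, p.tsum_coe] at this
  simpa using this

theorem map_fst_apply (p : PMF (α × ζ)) (a : α) : p.map Prod.fst a = ∑' z, p (a, z) := by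
  classical
  rw [PMF.map_apply, ENNReal.tsum_prod', tsum_eq_single a]
  · simp
  · intro b hb; simp [hb.symm]

theorem map_snd_apply (p : PMF (α × ζ)) (z : ζ) : p.map Prod.snd z = ∑' a, p (a, z) := by
  classical
  rw [PMF.map_apply, ENNReal.tsum_prod', ENNReal.tsum_comm, tsum_eq_single z]
  · simp
  · intro b hb; simp [hb.symm]

theorem map_prodMap_id_apply (p : PMF (α × ζ)) (h : ζ → ζ') (a : α) (z' : ζ') :
    p.map (Prod.map id h) (a, z') = ∑' z : {z // h z = z'}, p (a, z) := by
  classical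
  rw [PMF.map_apply, ENNReal.tsum_prod', tsum_eq_single a]
  · refine Eq.trans ?_ (tsum_subtype {z | h z = z'} fun z => p (a, z)).symm
    refine tsum_congr fun z => ?_
    simp [Set.indicator_apply, eq_comm]
  · intro b hb; simp [hb.symm]

theorem hasSum_toReal_of_tsum_eq {ι : Type*} {f : ι → ℝ≥0∞} {s : ℝ≥0∞} (hs : s ≠ ∞)
    (h : s = ∑' i, f i) : HasSum (fun i => (f i).toReal) s.toReal := by
  have h1 := ENNReal.hasSum_toReal (f := f) (h ▸ hs)
  rwa [← ENNReal.tsum_toReal_eq (ENNReal.ne_top_of_tsum_ne_top (h ▸ hs)), ← h] at h1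

end marginals

/-! ### Conditional entropy of a finite random variable -/

/-- The conditional entropy `H(F|Z)`, in nats, of a random variable `F` with a finite alphabet,
given a random variable `Z` with an arbitrary one. -/
def condEntropy {Ω α ζ : Type*} [Fintype α] (μ : PMF Ω) (F : Ω → α) (Z : Ω → ζ) : ℝ :=
  ∑' z, massEntropy fun a => ((μ.map fun ω => (F ω, Z ω)) (a, z)).toReal

section condEntropy

variable {Ω Ω' α β γ ζ ζ' : Type*} [Fintype α] [Fintype β]

/-- Superadditivity bounds the partial sums by the entropy of `F`, so the alphabet of `Z` may be
arbitrary. -/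
theorem summable_condEntropy (μ : PMF Ω) (F : Ω → α) (Z : Ω → ζ) :
    Summable fun z => massEntropy fun a => ((μ.map fun ω => (F ω, Z ω)) (a, z)).toReal :=
  (tsum_massEntropy_le (fun _ _ => ENNReal.toReal_nonneg)
    fun a => hasSum_toReal_of_tsum_eq (PMF.apply_ne_top _ a) (map_fst_apply _ a)).1

theorem condEntropy_congr {μ : PMF Ω} {ν : PMF Ω'} {F : Ω → α} {F' : Ω' → α} {Z : Ω → ζ}
    {Z' : Ω' → ζ} (h : (μ.map fun ω => (F ω, Z ω)) = ν.map fun ω => (F' ω, Z' ω)) :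
    condEntropy μ F Z = condEntropy ν F' Z' := by
  unfold condEntropy; rw [h]

theorem condEntropy_map (μ : PMF Ω) (f : Ω → Ω') (F : Ω' → α) (Z : Ω' → ζ) :
    condEntropy (μ.map f) F Z = condEntropy μ (fun ω => F (f ω)) fun ω => Z (f ω) :=
  condEntropy_congr (by rw [PMF.map_comp]; rfl)

theorem condEntropy_comp_equiv (μ : PMF Ω) (e : α ≃ β) (F : Ω → α) (Z : Ω → ζ) :
    condEntropy μ (fun ω => e (F ω)) Z = condEntropy μ F Z := by
  unfold condEntropy
  refine tsum_congr fun z => ?_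
  rw [← massEntropy_comp_equiv e]
  congr 1; ext a
  have h : (μ.map fun ω => (e (F ω), Z ω))
      = (μ.map fun ω => (F ω, Z ω)).map (Prod.map e id) := by rw [PMF.map_comp]; rfl
  rw [h]
  exact congrArg _ (map_apply_of_injective _ (e.injective.prodMap Function.injective_id) (a, z))

/-- The chain rule `H(F,G|Z) = H(G|Z) + H(F|G,Z)`. -/
theorem condEntropy_prod (μ : PMF Ω) (F : Ω → α) (G : Ω → β) (Z : Ω → ζ) :
    condEntropy μ (fun ω => (F ω, G ω)) Z
      = condEntropy μ G Z + condEntropy μ F fun ω => (G ω, Z ω) := by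
  set p := μ.map fun ω => (F ω, G ω, Z ω) with hp
  have h1 : ∀ a b z, (μ.map fun ω => ((F ω, G ω), Z ω)) ((a, b), z) = p (a, b, z) := by
    intro a b z
    have : (μ.map fun ω => ((F ω, G ω), Z ω)) = p.map (Equiv.prodAssoc α β ζ).symm := by
      rw [hp, PMF.map_comp]; rfl
    rw [this]
    exact map_apply_of_injective p (Equiv.prodAssoc α β ζ).symm.injective (a, b, z)
  have h2 : ∀ b z, ((μ.map fun ω => (G ω, Z ω)) (b, z)).toReal = ∑ a, (p (a, b, z)).toReal := by
    intro b z
    have : (μ.map fun ω => (G ω, Z ω)) = p.map Prod.snd := by rw [hp, PMF.map_comp]; rfl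
    rw [this, map_snd_apply, tsum_fintype, ENNReal.toReal_sum fun a _ => p.apply_ne_top _]
  have hs := summable_condEntropy μ F fun ω => (G ω, Z ω)
  have hs' := (Equiv.prodComm ζ β).summable_iff.2 hs
  have hr : condEntropy μ F (fun ω => (G ω, Z ω))
      = ∑' z, ∑ b, massEntropy fun a => (p (a, b, z)).toReal := by
    unfold condEntropy
    rw [← (Equiv.prodComm ζ β).tsum_eq]
    have := hs'.tsum_prod
    simp only [tsum_fintype] at this
    exact this
  have hsz : Summable fun z => ∑ b, massEntropy fun a => (p (a, b, z)).toReal := by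
    have := hs'.prod
    simp only [tsum_fintype] at this
    exact this
  rw [hr]
  unfold condEntropy
  rw [← (summable_condEntropy μ G Z).tsum_add hsz]
  refine tsum_congr fun z => ?_
  rw [massEntropy_prod]
  simp only [h1, h2]

/-- Conditioning on more reduces entropy. -/
theorem condEntropy_le_of_comp {μ : PMF Ω} {F : Ω → α} {Z : Ω → ζ} {Z' : Ω → ζ'} (h : ζ → ζ')
    (hZ : ∀ ω ∈ μ.support, Z' ω = h (Z ω)) : condEntropy μ F Z ≤ condEntropy μ F Z' := by
  set p := μ.map fun ω => (F ω, Z ω) with hp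
  have h1 : (μ.map fun ω => (F ω, Z' ω)) = p.map (Prod.map id h) := by
    rw [hp, PMF.map_comp]
    exact map_congr_support μ fun ω hω => by simp [hZ ω hω]
  -- Superadditivity over each fibre of `h`; summing over `z'` then gives the claim.
  have h2 : ∀ z', Summable (fun z : {z // h z = z'} => massEntropy fun a => (p (a, z)).toReal) ∧
      ∑' z : {z // h z = z'}, massEntropy (fun a => (p (a, z)).toReal)
        ≤ massEntropy fun a => ((p.map (Prod.map id h)) (a, z')).toReal := fun z' =>
    tsum_massEntropy_le (fun _ _ => ENNReal.toReal_nonneg)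
      fun a => hasSum_toReal_of_tsum_eq (PMF.apply_ne_top _ _) (map_prodMap_id_apply p h a z')
  have hs := summable_condEntropy μ F Z
  have hs' := (Equiv.sigmaFiberEquiv h).summable_iff.2 hs
  have e : condEntropy μ F Z
      = ∑' z', ∑' z : {z // h z = z'}, massEntropy fun a => (p (a, z)).toReal := by
    unfold condEntropy
    rw [← (Equiv.sigmaFiberEquiv h).tsum_eq]
    exact hs'.tsum_sigma' fun z' => (h2 z').1
  rw [e]
  unfold condEntropy
  have hs3 := summable_condEntropy μ F Z'
  rw [h1] at hs3 ⊢
  exact (hs'.sigma).tsum_le_tsum (fun z' => (h2 z').2) hs3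

/-- The functional dependence is asked on the support only, because a transcript is a function of a
view only among executions that can occur. -/
theorem condEntropy_le_of_determined {μ : PMF Ω} {F : Ω → α} {Z : Ω → ζ} {Z' : Ω → ζ'}
    (hZ : ∀ ω ∈ μ.support, ∀ ω' ∈ μ.support, Z ω = Z ω' → Z' ω = Z' ω') :
    condEntropy μ F Z ≤ condEntropy μ F Z' := by
  classical
  obtain ⟨ω₀, hω₀⟩ := μ.support_nonempty
  -- The value at points that `Z` does not reach on the support is arbitrary.
  refine condEntropy_le_of_comp (fun z => if h : ∃ ω ∈ μ.support, Z ω = z then Z' h.choose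
    else Z' ω₀) fun ω hω => ?_
  have h : ∃ ω' ∈ μ.support, Z ω' = Z ω := ⟨ω, hω, rfl⟩
  simp only [dif_pos h]
  exact hZ _ hω _ h.choose_spec.1 h.choose_spec.2.symm

theorem condEntropy_eq_of_determined {μ : PMF Ω} {F : Ω → α} {Z : Ω → ζ} {Z' : Ω → ζ'}
    (hZ : ∀ ω ∈ μ.support, ∀ ω' ∈ μ.support, Z ω = Z ω' ↔ Z' ω = Z' ω') :
    condEntropy μ F Z = condEntropy μ F Z' :=
  le_antisymm (condEntropy_le_of_determined fun ω h ω' h' => (hZ ω h ω' h').1)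
    (condEntropy_le_of_determined fun ω h ω' h' => (hZ ω h ω' h').2)

theorem condEntropy_le_of_map {μ : PMF Ω} {F : Ω → α} {Z : Ω → ζ} (h : ζ → ζ') :
    condEntropy μ F Z ≤ condEntropy μ F fun ω => h (Z ω) :=
  condEntropy_le_of_comp h fun _ _ => rfl

/-- The two expansions of `H(F,G|Z)` by the chain rule. -/
theorem condEntropy_comm (μ : PMF Ω) (F : Ω → α) (G : Ω → β) (Z : Ω → ζ) :
    condEntropy μ G Z + condEntropy μ F (fun ω => (G ω, Z ω))
      = condEntropy μ F Z + condEntropy μ G fun ω => (F ω, Z ω) := by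
  rw [← condEntropy_prod, ← condEntropy_prod,
    ← condEntropy_comp_equiv μ (Equiv.prodComm α β) (fun ω => (F ω, G ω)) Z]
  rfl

/-! #### Markov chains -/

/-- All marginals in the Markov identity are products of `u`, `v` and their sums over the outer
coordinate. -/
theorem isMarkov_of_factor {ζ₁ ζ₂ ζ₃ : Type*} {μ : PMF (ζ₁ × ζ₂ × ζ₃)} (u : ζ₁ → ζ₂ → ℝ≥0∞)
    (v : ζ₂ → ζ₃ → ℝ≥0∞) (h : ∀ a b c, μ (a, b, c) = u a b * v b c) : IsMarkov μ := by
  have h23 : ∀ b c, (μ.map fun t => t.2) (b, c) = (∑' a, u a b) * v b c := fun b c => by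
    rw [show (fun t : ζ₁ × ζ₂ × ζ₃ => t.2) = Prod.snd from rfl, map_snd_apply]
    simp only [h, ENNReal.tsum_mul_right]
  have h2 : ∀ b, (μ.map fun t => t.2.1) b = (∑' a, u a b) * ∑' c, v b c := fun b => by
    have : (μ.map fun t => t.2.1) = (μ.map fun t => t.2).map Prod.fst := by
      rw [PMF.map_comp]; rfl
    rw [this, map_fst_apply]
    simp only [h23, ENNReal.tsum_mul_left]
  have h12 : ∀ a b, (μ.map fun t => (t.1, t.2.1)) (a, b) = u a b * ∑' c, v b c := fun a b => by
    have : (μ.map fun t => (t.1, t.2.1))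
        = (μ.map (Equiv.prodAssoc ζ₁ ζ₂ ζ₃).symm).map Prod.fst := by
      rw [PMF.map_comp]; rfl
    rw [this, map_fst_apply, ← ENNReal.tsum_mul_left]
    refine tsum_congr fun c => ?_
    rw [← h]
    exact map_apply_of_injective μ (Equiv.prodAssoc ζ₁ ζ₂ ζ₃).symm.injective (a, b, c)
  intro a b c
  rw [h, h2, h12, h23]; ring

theorem IsMarkov.symm {ζ₁ ζ₂ ζ₃ : Type*} {μ : PMF (ζ₁ × ζ₂ × ζ₃)} (h : IsMarkov μ) :
    IsMarkov (μ.map fun t => (t.2.2, t.2.1, t.1)) := by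
  intro c b a
  have hinj : Function.Injective fun t : ζ₁ × ζ₂ × ζ₃ => (t.2.2, t.2.1, t.1) := by
    rintro ⟨a, b, c⟩ ⟨a', b', c'⟩ h; simp_all
  have e1 : (μ.map fun t => (t.2.2, t.2.1, t.1)) (c, b, a) = μ (a, b, c) :=
    map_apply_of_injective μ hinj (a, b, c)
  have e2 : ((μ.map fun t => (t.2.2, t.2.1, t.1)).map fun t => (t.1, t.2.1)) (c, b)
      = (μ.map fun t => t.2) (b, c) := by
    have : ((μ.map fun t => (t.2.2, t.2.1, t.1)).map fun t => (t.1, t.2.1))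
        = (μ.map fun t => t.2).map Prod.swap := by
      rw [PMF.map_comp, PMF.map_comp]; rfl
    rw [this]; exact map_apply_of_injective _ Prod.swap_injective (b, c)
  have e3 : ((μ.map fun t => (t.2.2, t.2.1, t.1)).map fun t => t.2) (b, a)
      = (μ.map fun t => (t.1, t.2.1)) (a, b) := by
    have : ((μ.map fun t => (t.2.2, t.2.1, t.1)).map fun t => t.2)
        = (μ.map fun t => (t.1, t.2.1)).map Prod.swap := by
      rw [PMF.map_comp, PMF.map_comp]; rfl
    rw [this]; exact map_apply_of_injective _ Prod.swap_injective (a, b)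
  rw [e1, e2, e3, PMF.map_comp, mul_comm ((μ.map fun t => t.2) (b, c)), ← h a b c]
  rfl

/-- In a Markov chain `F - Z - W`, `H(F|Z,W) = H(F|Z)`. -/
theorem condEntropy_of_isMarkov {μ : PMF Ω} {F : Ω → α} {Z : Ω → ζ} {W : Ω → ζ'}
    (h : IsMarkov (μ.map fun ω => (F ω, Z ω, W ω))) :
    condEntropy μ F (fun ω => (Z ω, W ω)) = condEntropy μ F Z := by
  set p := μ.map fun ω => (F ω, Z ω, W ω) with hp
  set q := μ.map fun ω => (F ω, Z ω) with hq
  set pz := μ.map Z with hpz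
  set pzw := μ.map fun ω => (Z ω, W ω) with hpzw
  have h' : ∀ a z w, p (a, z, w) * pz z = q (a, z) * pzw (z, w) := by
    intro a z w
    have := h a z w
    rw [PMF.map_comp, PMF.map_comp, PMF.map_comp] at this
    exact this
  have hz : ∀ z, pz z = ∑' w, pzw (z, w) := fun z => by
    rw [← map_fst_apply, hpzw, PMF.map_comp]; rfl
  have hqz : ∀ z, pz z = ∑' a, q (a, z) := fun z => by
    rw [← map_snd_apply, hq, PMF.map_comp]; rfl
  have hpq : ∀ a z, q (a, z) = ∑' w, p (a, z, w) := fun a z => by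
    have : q = (p.map (Equiv.prodAssoc α ζ ζ').symm).map Prod.fst := by
      rw [hp, PMF.map_comp, PMF.map_comp]; rfl
    rw [this, map_fst_apply]
    refine tsum_congr fun w => ?_
    exact map_apply_of_injective p (Equiv.prodAssoc α ζ ζ').symm.injective (a, z, w)
  -- By the Markov property the mass at `(z, w)` is the mass at `z` scaled by `p(w|z)`, and
  -- homogeneity pulls the scalar out. Where `p(z) = 0` both masses vanish.
  have hkey : ∀ z w, massEntropy (fun a => (p (a, z, w)).toReal)
      = massEntropy (fun a => (q (a, z)).toReal) * ((pzw (z, w)).toReal / (pz z).toReal) := by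
    intro z w
    rw [← massEntropy_mul_right]
    congr 1; ext a
    by_cases h0 : pz z = 0
    · have h1 : q (a, z) = 0 := by
        have := hqz z; rw [h0] at this
        exact ENNReal.tsum_eq_zero.1 this.symm a
      have h2 : p (a, z, w) = 0 := by
        have := hpq a z; rw [h1] at this
        exact ENNReal.tsum_eq_zero.1 this.symm w
      simp [h1, h2]
    · have h1 : (pz z).toReal ≠ 0 := ENNReal.toReal_ne_zero.2 ⟨h0, PMF.apply_ne_top _ _⟩
      have := congrArg ENNReal.toReal (h' a z w)
      rw [ENNReal.toReal_mul, ENNReal.toReal_mul] at this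
      field_simp
      exact this
  have hs := summable_condEntropy μ F fun ω => (Z ω, W ω)
  change ∑' zw : ζ × ζ', massEntropy (fun a => (p (a, zw)).toReal) = ∑' z, _
  rw [hs.tsum_prod]
  refine tsum_congr fun z => ?_
  refine (tsum_congr fun w => hkey z w).trans ?_
  rw [tsum_mul_left, tsum_div_const,
    (hasSum_toReal_of_tsum_eq (PMF.apply_ne_top _ _) (hz z)).tsum_eq]
  by_cases h0 : pz z = 0
  · have h1 : ∀ a, q (a, z) = 0 := fun a => by
      have := hqz z; rw [h0] at this
      exact ENNReal.tsum_eq_zero.1 this.symm a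
    change _ = massEntropy fun a => (q (a, z)).toReal
    simp [h1]
  · rw [div_self (ENNReal.toReal_ne_zero.2 ⟨h0, PMF.apply_ne_top _ _⟩), mul_one]

/-! #### Finite alphabets -/

theorem entropy_mul_log_two (p : PMF α) :
    entropy p * Real.log 2 = ∑ a, Real.negMulLog (p a).toReal := by
  have h : Real.log 2 ≠ 0 := (Real.log_pos one_lt_two).ne'
  rw [entropy, ← Finset.sum_div, div_mul_cancel₀ _ h]

theorem condEntropy_eq_entropy_sub (μ : PMF Ω) (F : Ω → α) (Z : Ω → β) :
    condEntropy μ F Z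
      = (entropy (μ.map fun ω => (F ω, Z ω)) - entropy (μ.map Z)) * Real.log 2 := by
  rw [sub_mul, entropy_mul_log_two, entropy_mul_log_two, Fintype.sum_prod_type_right,
    ← Finset.sum_sub_distrib, condEntropy, tsum_fintype]
  refine Finset.sum_congr rfl fun z _ => ?_
  rw [massEntropy]
  congr 2
  have : μ.map Z = (μ.map fun ω => (F ω, Z ω)).map Prod.snd := by rw [PMF.map_comp]; rfl
  rw [this, map_snd_apply, tsum_fintype, ENNReal.toReal_sum fun a _ => PMF.apply_ne_top _ _]

theorem condMutualInfo_mul_log_two [Fintype γ] (μ : PMF Ω) (A : Ω → α) (B : Ω → β) (C : Ω → γ) :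
    condMutualInfo μ A B C * Real.log 2
      = condEntropy μ A C - condEntropy μ A fun ω => (B ω, C ω) := by
  rw [condEntropy_eq_entropy_sub, condEntropy_eq_entropy_sub, condMutualInfo]
  ring

theorem condMutualInfo_mul_log_two' [Fintype γ] (μ : PMF Ω) (A : Ω → α) (B : Ω → β) (C : Ω → γ) :
    condMutualInfo μ A B C * Real.log 2
      = condEntropy μ B C - condEntropy μ B fun ω => (A ω, C ω) := by
  rw [condMutualInfo_mul_log_two]
  linarith [condEntropy_comm μ A B C]

end condEntropy

/-! ### Total variation distance -/

section tvDist

variable {α β : Type*}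

theorem map_apply_fiber (p : PMF α) (f : α → β) (b : β) :
    p.map f b = ∑' a : {a // f a = b}, p a := by
  classical
  rw [PMF.map_apply]
  refine Eq.trans ?_ (tsum_subtype {a | f a = b} p).symm
  refine tsum_congr fun a => ?_
  simp [Set.indicator_apply, eq_comm]

theorem summable_abs_sub (p q : PMF α) : Summable fun a => |(p a).toReal - (q a).toReal| :=
  ((hasSum_toReal p).sub (hasSum_toReal q)).summable.abs

theorem tvDist_comm (p q : PMF α) : tvDist p q = tvDist q p := by
  simp only [tvDist, abs_sub_comm]

theorem tvDist_nonneg (p q : PMF α) : 0 ≤ tvDist p q :=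
  div_nonneg (tsum_nonneg fun _ => abs_nonneg _) two_pos.le

theorem tvDist_triangle (p q r : PMF α) : tvDist p r ≤ tvDist p q + tvDist q r := by
  unfold tvDist
  rw [← add_div, ← (summable_abs_sub p q).tsum_add (summable_abs_sub q r)]
  gcongr
  · exact summable_abs_sub p r
  · exact (summable_abs_sub p q).add (summable_abs_sub q r)
  · exact abs_sub_le _ _ _

/-- The triangle inequality on each fibre of `f`. -/
theorem tvDist_map_le (p q : PMF α) (f : α → β) : tvDist (p.map f) (q.map f) ≤ tvDist p q := by
  have hs := (Equiv.sigmaFiberEquiv f).summable_iff.2 (summable_abs_sub p q)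
  set u : α → ℝ := fun a => |(p a).toReal - (q a).toReal| with hu
  change Summable fun x : Σ b, {a // f a = b} => u x.2 at hs
  have e : ∑' a, u a = ∑' b, ∑' a : {a // f a = b}, u a := by
    rw [← (Equiv.sigmaFiberEquiv f).tsum_eq]
    exact hs.tsum_sigma
  have hb : ∀ b, |(p.map f b).toReal - (q.map f b).toReal| ≤ ∑' a : {a // f a = b}, u a := by
    intro b
    have h := (hasSum_toReal_of_tsum_eq (PMF.apply_ne_top _ _) (map_apply_fiber p f b)).sub
      (hasSum_toReal_of_tsum_eq (PMF.apply_ne_top _ _) (map_apply_fiber q f b))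
    exact h.norm_le_of_bounded (hs.sigma_factor b).hasSum fun a => le_rfl
  unfold tvDist
  rw [e]
  exact div_le_div_of_nonneg_right ((summable_abs_sub _ _).tsum_le_tsum hb hs.sigma) two_pos.le

/-- The overlap of the two laws, from `min x y = (x + y - |x - y|) / 2`. -/
theorem hasSum_min (p q : PMF α) :
    HasSum (fun a => min (p a).toReal (q a).toReal) (1 - tvDist p q) := by
  have h := (((hasSum_toReal p).add (hasSum_toReal q)).sub
    (summable_abs_sub p q).hasSum).div_const 2
  have e : (fun a => min (p a).toReal (q a).toReal) = fun a =>
      ((p a).toReal + (q a).toReal - |(p a).toReal - (q a).toReal|) / 2 := by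
    ext a
    rcases le_total (p a).toReal (q a).toReal with h' | h'
    · rw [min_eq_left h', abs_of_nonpos (sub_nonpos.2 h')]; ring
    · rw [min_eq_right h', abs_of_nonneg (sub_nonneg.2 h')]; ring
  have e' : 1 - tvDist p q = (1 + 1 - ∑' a, |(p a).toReal - (q a).toReal|) / 2 := by
    rw [tvDist]; ring
  rw [e, e']
  exact h

/-- Two laws that dominate a common mass function of total mass `1 - δ` are `δ`-close. -/
theorem tvDist_le_of_le {p q : PMF α} {m : α → ℝ≥0∞} (hp : ∀ a, m a ≤ p a) (hq : ∀ a, m a ≤ q a) :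
    tvDist p q ≤ 1 - (∑' a, m a).toReal := by
  have hle : ∑' a, m a ≤ 1 := (ENNReal.tsum_le_tsum hp).trans p.tsum_coe.le
  have hm := hasSum_toReal_of_tsum_eq (ne_top_of_le_ne_top ENNReal.one_ne_top hle) rfl
  have h := ((hasSum_toReal p).sub hm).add ((hasSum_toReal q).sub hm)
  have : ∑' a, |(p a).toReal - (q a).toReal|
      ≤ (1 - (∑' a, m a).toReal) + (1 - (∑' a, m a).toReal) := by
    rw [← h.tsum_eq]
    refine (summable_abs_sub p q).tsum_le_tsum (fun a => ?_) h.summable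
    have h1 := ENNReal.toReal_mono (p.apply_ne_top a) (hp a)
    have h2 := ENNReal.toReal_mono (q.apply_ne_top a) (hq a)
    rw [abs_le]
    constructor <;> linarith
  rw [tvDist]
  linarith

end tvDist

/-! ### Continuity of conditional entropy -/

/-- The modulus of continuity of the entropy on an alphabet of size `k`, conditioned on anything. -/
def entropyModulus (k : ℕ) (ε : ℝ) : ℝ := ε * Real.log k + Real.binEntropy ε

/-- The continuity bound of Alicki, Fannes and Winter. -/
theorem condEntropy_le_add_entropyModulus {Ω Ω' α ζ : Type*} [Fintype α] {μ : PMF Ω} {ν : PMF Ω'}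
    {F : Ω → α} {Z : Ω → ζ} {F' : Ω' → α} {Z' : Ω' → ζ} {ε : ℝ}
    (h : tvDist (ν.map fun ω => (F' ω, Z' ω)) (μ.map fun ω => (F ω, Z ω)) ≤ ε) (hε : ε ≤ 1 / 2) :
    condEntropy ν F' Z' ≤ condEntropy μ F Z + entropyModulus (Fintype.card α) ε := by
  have hsp := summable_condEntropy μ F Z
  have hsq := summable_condEntropy ν F' Z'
  unfold condEntropy
  set p := μ.map fun ω => (F ω, Z ω)
  set q := ν.map fun ω => (F' ω, Z' ω)
  -- The overlap `m` has mass `1 - δ` and lies below both laws; the excess `d` of `q` over it has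
  -- mass `δ`.
  set m : α × ζ → ℝ := fun t => min (p t).toReal (q t).toReal with hm
  set d : α × ζ → ℝ := fun t => (q t).toReal - m t with hd
  have hm0 : ∀ t, 0 ≤ m t := fun t => le_min ENNReal.toReal_nonneg ENNReal.toReal_nonneg
  have hd0 : ∀ t, 0 ≤ d t := fun t => sub_nonneg.2 (min_le_right _ _)
  set δ := tvDist q p with hδ
  have hmsum : HasSum m (1 - δ) := by
    rw [hδ, tvDist_comm]
    exact hasSum_min p q
  have hdsum : HasSum d δ := by simpa using (hasSum_toReal q).sub hmsum
  have hfib : ∀ {f : α × ζ → ℝ} {s : ℝ}, HasSum f s → HasSum (fun z => ∑ a, f (a, z)) s := by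
    intro f s hf
    exact ((Equiv.prodComm ζ α).hasSum_iff.2 hf).prod_fiberwise fun z => hasSum_fintype _
  have hdz := hfib hdsum
  have hmz := hfib hmsum
  have hδ0 : 0 ≤ δ := tvDist_nonneg _ _
  -- The bit that tells overlap from excess: its entropy given `z`, summed over `z`, is at most the
  -- binary entropy of `δ`.
  obtain ⟨hbs, hb⟩ := tsum_massEntropy_le
    (v := fun z (b : Bool) => if b then ∑ a, m (a, z) else ∑ a, d (a, z))
    (V := fun b => if b then 1 - δ else δ)
    (by rintro z (_ | _) <;> simp [Finset.sum_nonneg, hm0, hd0])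
    (by rintro (_ | _) <;> simpa)
  -- Splitting `q = m + d` costs the entropy of the bit. The part `m` has at most the entropy of
  -- `p`, by superadditivity, and `d` at most its mass times the logarithm of the alphabet size.
  have hpt : ∀ z, massEntropy (fun a => (q (a, z)).toReal)
      ≤ massEntropy (fun a => (p (a, z)).toReal)
        + (∑ a, d (a, z)) * Real.log (Fintype.card α)
        + massEntropy fun b : Bool => if b then ∑ a, m (a, z) else ∑ a, d (a, z) := by
    intro z
    have h1 := massEntropy_add_le (v := fun a => m (a, z)) (w := fun a => d (a, z))
      (fun a => hm0 _) fun a => hd0 _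
    have h2 := massEntropy_add_le_add (v := fun a => m (a, z))
      (w := fun a => (p (a, z)).toReal - m (a, z)) (fun a => hm0 _)
      fun a => sub_nonneg.2 (min_le_left _ _)
    have h3 := massEntropy_nonneg (v := fun a => (p (a, z)).toReal - m (a, z))
      fun a => sub_nonneg.2 (min_le_left _ _)
    have h4 := massEntropy_le_mul_log_card (v := fun a => d (a, z)) fun a => hd0 _
    simp only [hd, add_sub_cancel] at h1 h2 h4 ⊢
    linarith
  have hs2 := (hsp.add (hdz.summable.mul_right (Real.log (Fintype.card α)))).add hbs
  have hle := hsq.tsum_le_tsum hpt hs2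
  rw [(hsp.add (hdz.summable.mul_right _)).tsum_add hbs,
    hsp.tsum_add (hdz.summable.mul_right _), tsum_mul_right, hdz.tsum_eq] at hle
  have hbin : massEntropy (fun b : Bool => if b then 1 - δ else δ) = Real.binEntropy δ := by
    simp [massEntropy, Real.binEntropy_eq_negMulLog_add_negMulLog_one_sub]
    ring
  rw [hbin] at hb
  -- The binary entropy increases only up to `1 / 2`, hence the restriction on `ε`.
  have hmono := Real.binEntropy_strictMonoOn.monotoneOn (a := δ) (b := ε)
    ⟨hδ0, by rw [← one_div]; linarith⟩ ⟨hδ0.trans h, by rw [← one_div]; linarith⟩ h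
  have hlog := mul_le_mul_of_nonneg_right h (Real.log_natCast_nonneg (Fintype.card α))
  unfold entropyModulus
  linarith

/-! ### The local behaviour of a party -/

namespace View

variable {I S M O : Type*}

/-- The view after the other party's turn, in which it sent a message or nothing. -/
def receive (v : View I S M O) : Option M → View I S M O
  | some m => { v with history := .received m :: v.history }
  | none => v

/-- The view after a turn of its own, with the message sent, if any. -/
def turn (k : View I S M O → PMF ((S × M) ⊕ O)) (v : View I S M O) :
    PMF (View I S M O × Option M) :=
  match v.output with
  | some _ => PMF.pure (v, none)
  | none => (k v).map fun
      | .inl (s, m) => ({ v with history := .sent s m :: v.history }, some m)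
      | .inr u => ({ v with output := some u }, none)

theorem setup_receive (v : View I S M O) (o : Option M) : (v.receive o).setup = v.setup := by
  cases o <;> rfl

theorem output_receive (v : View I S M O) (o : Option M) : (v.receive o).output = v.output := by
  cases o <;> rfl

theorem turn_cases {k : View I S M O → PMF ((S × M) ⊕ O)} {v : View I S M O}
    {r : View I S M O × Option M} (h : v.turn k r ≠ 0) :
    (v.output ≠ none ∧ r = (v, none)) ∨
    (v.output = none ∧ ∃ s m, r = ({ v with history := .sent s m :: v.history }, some m)) ∨
    (v.output = none ∧ ∃ u, r = ({ v with output := some u }, none)) := by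
  rw [← PMF.mem_support_iff] at h
  unfold turn at h
  split at h
  · rename_i h'
    refine .inl ⟨by simp [h'], by simpa using h⟩
  · rename_i h'
    rw [PMF.mem_support_map_iff] at h
    obtain ⟨(⟨s, m⟩ | u), -, rfl⟩ := h
    · exact .inr (.inl ⟨h', s, m, rfl⟩)
    · exact .inr (.inr ⟨h', u, rfl⟩)

theorem setup_turn {k : View I S M O → PMF ((S × M) ⊕ O)} {v : View I S M O}
    {r : View I S M O × Option M} (h : v.turn k r ≠ 0) : r.1.setup = v.setup := by
  rcases turn_cases h with ⟨-, rfl⟩ | ⟨-, s, m, rfl⟩ | ⟨-, u, rfl⟩ <;> rfl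

end View

/-- Whether the party `e` is to move in turn `n`; the party `true` moves in turn `0`. -/
abbrev Moves (e : Bool) (n : ℕ) : Prop := decide (Even n) = e

section weight

variable {I S M O : Type*} (k : View I S M O → PMF ((S × M) ⊕ O)) (e : Bool)

/-- The weight with which a party passes in turn `n` from the view `v` to the view `v'`, the message
of that turn being `o`. -/
def stepWeight (n : ℕ) (o : Option M) (v v' : View I S M O) : ℝ≥0∞ :=
  if Moves e n then v.turn k (v', o) else PMF.pure (v.receive o) v'

/-- The contribution of a party to the probability of a transcript (the messages of all turns,
latest first) and a view after `n` turns. -/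
def partyWeight : ℕ → List (Option M) → View I S M O → ℝ≥0∞
  | 0, [], v => PMF.pure (([], none) : List (Event S M) × Option O) (v.history, v.output)
  | 0, _ :: _, _ => 0
  | _ + 1, [], _ => 0
  | n + 1, o :: t, v' => ∑' v, partyWeight n t v * stepWeight k e n o v v'

theorem setup_of_stepWeight_ne_zero {n : ℕ} {o : Option M} {v v' : View I S M O}
    (h : stepWeight k e n o v v' ≠ 0) : v'.setup = v.setup := by
  unfold stepWeight at h
  split_ifs at h
  · exact View.setup_turn h
  · rw [← PMF.mem_support_iff] at h
    simp only [PMF.support_pure, Set.mem_singleton_iff] at h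
    rw [h, View.setup_receive]

/-- The messages of a transcript, marked with the party that sent them. -/
def marked : List (Option M) → List (Bool × M)
  | [] => []
  | none :: t => marked t
  | some m :: t => (decide (Even t.length), m) :: marked t

/-- The message of an event in the history of party `e`, marked with the party that sent it. -/
def Event.mark : Event S M → Bool × M
  | .sent _ m => (e, m)
  | .received m => (!e, m)

/-- The number of turns of party `e` among the first `n`. -/
def turns (n : ℕ) : ℕ := Nat.count (Moves e) n

/-- The number of messages of party `e`. -/
def sentBy (l : List (Bool × M)) : ℕ := l.countP fun x => x.1 == e

/-- The party `e` sends no message after a turn in which it has sent none. -/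
def Coherent : List (Option M) → Prop
  | [] => True
  | o :: t => Coherent t ∧
      (Moves e t.length → o.isSome → sentBy e (marked t) = turns e t.length)

theorem turns_succ (n : ℕ) : turns e (n + 1) = turns e n + if Moves e n then 1 else 0 :=
  Nat.count_succ _ _

theorem sentBy_marked_cons (o : Option M) (t : List (Option M)) :
    sentBy e (marked (o :: t)) = sentBy e (marked t)
      + if Moves e t.length ∧ o.isSome then 1 else 0 := by
  cases o with
  | none => simp [marked]
  | some m => simp [marked, sentBy, List.countP_cons]

theorem sentBy_marked_le (t : List (Option M)) : sentBy e (marked t) ≤ turns e t.length := by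
  induction t with
  | nil => simp [marked, sentBy]
  | cons o t ih =>
    rw [sentBy_marked_cons, List.length_cons, turns_succ]
    split_ifs <;> simp_all
    omega

/-- A transcript is determined by its length and its marked messages. -/
theorem eq_of_marked_eq : ∀ {t t' : List (Option M)}, t.length = t'.length → (∀ e, Coherent e t) →
    (∀ e, Coherent e t') → marked t = marked t' → t = t'
  | [], [], _, _, _, _ => rfl
  | o :: t, o' :: t', hl, h, h', hm => by
    have hl' : t.length = t'.length := by simpa using hl
    -- If the latest turn has a message in one transcript and none in the other, coherence says that
    -- its mover has sent a message in all its earlier turns of the first. The second would then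
    -- need one message more than the mover had earlier turns.
    have main : ∀ {s s' : List (Option M)} {m : M}, s.length = s'.length →
        (∀ e, Coherent e (some m :: s)) → marked (some m :: s) ≠ marked (none :: s') := by
      intro s s' m hs hc hms
      have h1 := (hc (decide (Even s.length))).2 rfl rfl
      have h2 := sentBy_marked_le (decide (Even s.length)) s'
      rw [← show marked (some m :: s) = marked s' from hms, sentBy_marked_cons, ← hs] at h2
      simp at h2
      omega
    cases o with
    | none =>
      cases o' with
      | none =>
        rw [eq_of_marked_eq hl' (fun e => (h e).1) (fun e => (h' e).1) hm]
      | some m => exact absurd hm.symm (main hl'.symm h')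
    | some m =>
      cases o' with
      | none => exact absurd hm (main hl' h)
      | some m' =>
        simp only [marked, List.cons.injEq, Prod.mk.injEq] at hm
        rw [eq_of_marked_eq hl' (fun e => (h e).1) (fun e => (h' e).1) hm.2, hm.1.2]

/-- The last clause carries the induction: only terminating, or having terminated, makes a party
silent in its own turn, so a party without output has spoken in all its turns. This yields
coherence. Silent turns leave no trace in a view's history, and coherence is what recovers them. -/
theorem partyWeight_ne_zero : ∀ {n : ℕ} {t : List (Option M)} {v : View I S M O},
    partyWeight k e n t v ≠ 0 → t.length = n ∧ v.history.map (Event.mark e) = marked t ∧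
      Coherent e t ∧ (v.output = none → sentBy e (marked t) = turns e n)
  | 0, [], v, h => by
    rw [partyWeight, ← PMF.mem_support_iff] at h
    simp only [PMF.support_pure, Set.mem_singleton_iff, Prod.mk.injEq] at h
    simp [h.1, marked, Coherent, sentBy, turns]
  | 0, _ :: _, _, h => absurd rfl h
  | _ + 1, [], _, h => absurd rfl h
  | n + 1, o :: t, v', h => by
    rw [partyWeight] at h
    obtain ⟨v, hv⟩ : ∃ v, partyWeight k e n t v * stepWeight k e n o v v' ≠ 0 := by
      by_contra! hc
      exact h (by simp [hc])
    obtain ⟨hl, hh, hc, ho⟩ := partyWeight_ne_zero (left_ne_zero_of_mul hv)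
    have hs := right_ne_zero_of_mul hv
    subst hl
    unfold stepWeight at hs
    rw [turns_succ, sentBy_marked_cons]
    split_ifs at hs with hm
    · rcases View.turn_cases hs with ⟨h1, h2⟩ | ⟨h1, s, m, h2⟩ | ⟨h1, u, h2⟩
      · obtain ⟨rfl, rfl⟩ := Prod.mk.inj h2
        exact ⟨rfl, hh, ⟨hc, by simp⟩, fun h => absurd h h1⟩
      · obtain ⟨rfl, rfl⟩ := Prod.mk.inj h2
        refine ⟨rfl, ?_, ⟨hc, fun _ _ => ho h1⟩, fun _ => ?_⟩
        · have hm' : decide (Even t.length) = e := hm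
          simp [marked, hh, Event.mark, hm']
        · simp [ho h1]
      · obtain ⟨rfl, rfl⟩ := Prod.mk.inj h2
        exact ⟨rfl, hh, ⟨hc, by simp⟩, by simp⟩
    · rw [← PMF.mem_support_iff] at hs
      simp only [PMF.support_pure, Set.mem_singleton_iff] at hs
      subst hs
      refine ⟨rfl, ?_, ⟨hc, fun h => absurd h hm⟩, fun h => ?_⟩
      · have hm' : decide (Even t.length) = !e := by
          cases e <;> simpa using hm
        cases o <;> simp [View.receive, marked, hh, Event.mark, hm']
      · rw [View.output_receive] at h
        simp [hm, ho h]

end weight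

/-! ### Runs with transcript and side information -/

theorem jointLaw_apply {X Y Q : Type*} (P : PMF (X × Y)) (K : X × Y → PMF Q) (x : X) (y : Y)
    (q : Q) : jointLaw P K (x, y, q) = P (x, y) * K (x, y) q := by
  rw [jointLaw, PMF.bind_apply, tsum_eq_single (x, y)]
  · congr 1
    exact map_apply_of_injective _ (f := fun q => (x, y, q)) (fun q q' h => by simpa using h) q
  · rintro ⟨x', y'⟩ h
    have : ((K (x', y')).map fun q => (x', y', q)) (x, y, q) = 0 := by
      rw [← not_ne_iff, ← PMF.mem_support_iff, PMF.mem_support_map_iff]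
      rintro ⟨q', -, h'⟩
      simp only [Prod.mk.injEq] at h'
      exact h (by simp [h'.1, h'.2.1])
    simp [this]

theorem jointLaw_map_fst {X Y Q : Type*} (P : PMF (X × Y)) (K : X × Y → PMF Q) :
    (jointLaw P K).map (fun t => (t.1, t.2.1)) = P := by
  rw [jointLaw, PMF.map_bind]
  refine Eq.trans ?_ (PMF.bind_pure P)
  congr 1; ext1 w
  rw [PMF.map_comp]
  exact PMF.map_const (K w) w

namespace Protocol

variable {X Y U V Q : Type*} (π : Protocol X Y U V)

/-- A turn, recording the message. -/
def tracedStep (n : ℕ) (ω : Q × List (Option π.M) × π.Config) :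
    PMF (Q × List (Option π.M) × π.Config) :=
  if Even n then
    (ω.2.2.1.turn π.alice).map fun r => (ω.1, r.2 :: ω.2.1, r.1, ω.2.2.2.receive r.2)
  else (ω.2.2.2.turn π.bob).map fun r => (ω.1, r.2 :: ω.2.1, ω.2.2.1.receive r.2, r.1)

/-- The law of side information about the set up, the transcript and the views after `n` turns,
where `J` is the joint law of the set up and the side information. -/
def tracedRun (J : PMF (X × Y × Q)) : ℕ → PMF (Q × List (Option π.M) × π.Config)
  | 0 => J.map fun w => (w.2.2, [], ⟨w.1, [], none⟩, ⟨w.2.1, [], none⟩)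
  | n + 1 => (tracedRun J n).bind (π.tracedStep n)

theorem aliceTurn_eq (c : π.Config) :
    π.aliceTurn c = (c.1.turn π.alice).map fun r => (r.1, c.2.receive r.2) := by
  unfold aliceTurn View.turn
  cases h : c.1.output with
  | some u => simp [PMF.pure_map, View.receive]
  | none =>
    simp only [PMF.map_comp]
    congr 1; ext1 r
    rcases r with ⟨s, m⟩ | u <;> simp [View.receive, h]

theorem bobTurn_eq (c : π.Config) :
    π.bobTurn c = (c.2.turn π.bob).map fun r => (c.1.receive r.2, r.1) := by
  unfold bobTurn View.turn
  cases h : c.2.output with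
  | some u => simp [PMF.pure_map, View.receive]
  | none =>
    simp only [PMF.map_comp]
    congr 1; ext1 r
    rcases r with ⟨s, m⟩ | u <;> simp [View.receive, h]

theorem tracedRun_map_config (P : PMF (X × Y)) (K : X × Y → PMF Q) (n : ℕ) :
    (π.tracedRun (jointLaw P K) n).map (fun ω => ω.2.2) = π.run P n := by
  induction n with
  | zero =>
    rw [tracedRun, PMF.map_comp, run]
    conv_rhs => rw [← jointLaw_map_fst P K, PMF.map_comp]
    rfl
  | succ n ih =>
    rw [tracedRun, PMF.map_bind, run, ← ih, PMF.bind_map]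
    congr 1; ext1 ω
    simp only [tracedStep, Function.comp_apply]
    split_ifs
    · rw [PMF.map_comp, aliceTurn_eq]; rfl
    · rw [PMF.map_comp, bobTurn_eq]; rfl

theorem tracedStep_setup {n : ℕ} {ω ω' : Q × List (Option π.M) × π.Config}
    (h : ω' ∈ (π.tracedStep n ω).support) : ω'.1 = ω.1 ∧
      ω'.2.2.1.setup = ω.2.2.1.setup ∧ ω'.2.2.2.setup = ω.2.2.2.setup ∧ ω'.2.1.tail = ω.2.1 := by
  unfold tracedStep at h
  split_ifs at h <;> rw [PMF.mem_support_map_iff] at h <;> obtain ⟨r, hr, rfl⟩ := h <;>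
    simp [View.setup_receive, View.setup_turn ((PMF.mem_support_iff _ _).1 hr)]

theorem tracedRun_succ_map (J : PMF (X × Y × Q)) (n : ℕ) :
    (π.tracedRun J (n + 1)).map (fun ω => (ω.2.2.1.setup, ω.2.2.2.setup, ω.1, ω.2.1.tail))
      = (π.tracedRun J n).map fun ω => (ω.2.2.1.setup, ω.2.2.2.setup, ω.1, ω.2.1) := by
  rw [tracedRun, PMF.map_bind, ← PMF.bind_pure_comp]
  congr 1; ext1 ω
  rw [map_congr_support (g := Function.const _ (ω.2.2.1.setup, ω.2.2.2.setup, ω.1, ω.2.1)),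
    PMF.map_const]
  · rfl
  · intro ω' h
    obtain ⟨h1, h2, h3, h4⟩ := π.tracedStep_setup h
    simp [h1, h2, h3, h4]

/-- No turn alters the set up or the side information, so their joint law stays `J`. -/
theorem tracedRun_map_setup (J : PMF (X × Y × Q)) (n : ℕ) :
    (π.tracedRun J n).map (fun ω => (ω.2.2.1.setup, ω.2.2.2.setup, ω.1)) = J := by
  induction n with
  | zero => rw [tracedRun, PMF.map_comp]; exact PMF.map_id J
  | succ n ih =>
    conv_rhs => rw [← ih]
    have := congrArg (PMF.map fun w : X × Y × Q × List (Option π.M) => (w.1, w.2.1, w.2.2.1))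
      (π.tracedRun_succ_map J n)
    rw [PMF.map_comp, PMF.map_comp] at this
    exact this

/-- Once the message of the turn is fixed, the random move of one party and the deterministic update
of the other separate. -/
theorem tracedStep_cons_apply (n : ℕ) (q q' : Q) (o : Option π.M) (t t' : List (Option π.M))
    (a a' : π.ViewA) (b b' : π.ViewB) :
    π.tracedStep n (q, t, a, b) (q', o :: t', a', b')
      = PMF.pure (q, t) (q', t') * (stepWeight π.alice true n o a a' *
        stepWeight π.bob false n o b b') := by
  classical
  unfold tracedStep stepWeight Moves
  by_cases hn : Even n
  · simp only [hn, if_true, decide_true, Bool.true_eq_false, if_false, PMF.pure_apply]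
    rw [PMF.map_apply, tsum_eq_single (a', o)]
    · simp only [Prod.mk.injEq, List.cons.injEq, true_and]
      split_ifs <;> simp_all
    · rintro ⟨a'', o''⟩ h
      rw [if_neg]
      simp only [Prod.mk.injEq, List.cons.injEq]
      rintro ⟨-, ⟨rfl, -⟩, rfl, -⟩
      exact h rfl
  · simp only [hn, if_true, decide_false, Bool.false_eq_true, if_false, PMF.pure_apply]
    rw [PMF.map_apply, tsum_eq_single (b', o)]
    · simp only [Prod.mk.injEq, List.cons.injEq, true_and]
      split_ifs <;> simp_all
    · rintro ⟨b'', o''⟩ h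
      rw [if_neg]
      simp only [Prod.mk.injEq, List.cons.injEq]
      rintro ⟨-, ⟨rfl, -⟩, -, rfl⟩
      exact h rfl

/-- Given the set up and the side information, the law of transcript and views is a product of
contributions of the two parties. -/
theorem tracedRun_apply (J : PMF (X × Y × Q)) : ∀ (n : ℕ) (q : Q) (t : List (Option π.M))
    (a : π.ViewA) (b : π.ViewB), π.tracedRun J n (q, t, a, b)
      = J (a.setup, b.setup, q) * (partyWeight π.alice true n t a * partyWeight π.bob false n t b)
  | 0, q, [], ⟨x, h, o⟩, ⟨y, h', o'⟩ => by
    classical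
    rw [tracedRun, partyWeight, partyWeight, PMF.map_apply, tsum_eq_single (x, y, q)]
    · simp only [PMF.pure_apply, Prod.mk.injEq, true_and, View.mk.injEq]
      split_ifs <;> simp_all
    · rintro ⟨x', y', q'⟩ hne
      rw [if_neg]
      simp only [Prod.mk.injEq, View.mk.injEq]
      rintro ⟨rfl, -, ⟨rfl, -, -⟩, rfl, -, -⟩
      exact hne rfl
  | 0, q, o :: t, a, b => by
    classical
    rw [tracedRun, partyWeight, PMF.map_apply]
    simp
  | n + 1, q, [], a, b => by
    rw [partyWeight, zero_mul, mul_zero, ← not_ne_iff, ← PMF.mem_support_iff, tracedRun,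
      PMF.mem_support_bind_iff]
    rintro ⟨ω, -, h⟩
    unfold tracedStep at h
    split_ifs at h <;> rw [PMF.mem_support_map_iff] at h <;> obtain ⟨r, -, h⟩ := h <;>
      simp at h
  | n + 1, q, o :: t, a', b' => by
    classical
    -- Only the same `q` and the transcript `t` without its latest entry can precede. The remaining
    -- sum over pairs of earlier views is a product of two sums.
    rw [tracedRun, PMF.bind_apply, ENNReal.tsum_prod', tsum_eq_single q, ENNReal.tsum_prod',
      tsum_eq_single t]
    · rw [ENNReal.tsum_prod', partyWeight, partyWeight, ← ENNReal.tsum_mul_right,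
        ← ENNReal.tsum_mul_left]
      refine tsum_congr fun a => ?_
      rw [← ENNReal.tsum_mul_left, ← ENNReal.tsum_mul_left]
      refine tsum_congr fun b => ?_
      rw [tracedStep_cons_apply, tracedRun_apply J n]
      -- A nonzero weight preserves the set up, so the factor `J` is the same before and after the
      -- turn.
      by_cases ha : stepWeight π.alice true n o a a' = 0
      · simp [ha]
      by_cases hb : stepWeight π.bob false n o b b' = 0
      · simp [hb]
      rw [setup_of_stepWeight_ne_zero _ _ ha, setup_of_stepWeight_ne_zero _ _ hb]
      simp only [PMF.pure_apply, if_true, one_mul]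
      ring
    · intro t' ht'
      rw [ENNReal.tsum_eq_zero]
      rintro ⟨a, b⟩
      rw [tracedStep_cons_apply]
      simp [ht'.symm]
    · intro q' hq'
      rw [ENNReal.tsum_eq_zero]
      rintro ⟨t', a, b⟩
      rw [tracedStep_cons_apply]
      simp [hq'.symm]

theorem tracedRun_coherent {J : PMF (X × Y × Q)} {n : ℕ} {ω : Q × List (Option π.M) × π.Config}
    (h : ω ∈ (π.tracedRun J n).support) : ω.2.1.length = n ∧ (∀ e, Coherent e ω.2.1) ∧
      ω.2.2.1.history.map (Event.mark true) = marked ω.2.1 ∧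
      ω.2.2.2.history.map (Event.mark false) = marked ω.2.1 := by
  obtain ⟨q, t, a, b⟩ := ω
  rw [PMF.mem_support_iff, tracedRun_apply] at h
  have h := right_ne_zero_of_mul h
  obtain ⟨h1, h2, h3, -⟩ := partyWeight_ne_zero _ _ (left_ne_zero_of_mul h)
  obtain ⟨-, h2', h3', -⟩ := partyWeight_ne_zero _ _ (right_ne_zero_of_mul h)
  exact ⟨h1, by rintro (_ | _) <;> assumption, h2, h2'⟩

/-- The transcript is a function of Alice's view. -/
theorem transcript_eq_of_viewA_eq {J : PMF (X × Y × Q)} {n : ℕ}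
    {ω ω' : Q × List (Option π.M) × π.Config} (h : ω ∈ (π.tracedRun J n).support)
    (h' : ω' ∈ (π.tracedRun J n).support) (hv : ω.2.2.1 = ω'.2.2.1) : ω.2.1 = ω'.2.1 := by
  obtain ⟨h1, h2, h3, -⟩ := π.tracedRun_coherent h
  obtain ⟨h1', h2', h3', -⟩ := π.tracedRun_coherent h'
  exact eq_of_marked_eq (h1.trans h1'.symm) h2 h2' (by rw [← h3, ← h3', hv])

/-- The transcript is a function of Bob's view. -/
theorem transcript_eq_of_viewB_eq {J : PMF (X × Y × Q)} {n : ℕ}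
    {ω ω' : Q × List (Option π.M) × π.Config} (h : ω ∈ (π.tracedRun J n).support)
    (h' : ω' ∈ (π.tracedRun J n).support) (hv : ω.2.2.2 = ω'.2.2.2) : ω.2.1 = ω'.2.1 := by
  obtain ⟨h1, h2, -, h3⟩ := π.tracedRun_coherent h
  obtain ⟨h1', h2', -, h3'⟩ := π.tracedRun_coherent h'
  exact eq_of_marked_eq (h1.trans h1'.symm) h2 h2' (by rw [← h3, ← h3', hv])

end Protocol

/-! ### Information inequalities along a run -/

section factor

variable {Ω Ω' ζ₁ ζ₂ ζ₃ ζ₁' ζ₃' : Type*}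

theorem map_apply_eq_zero (p : PMF Ω) {f : Ω → Ω'} {b : Ω'} (h : ∀ ω, f ω ≠ b) :
    p.map f b = 0 := by
  rw [← not_ne_iff, ← PMF.mem_support_iff, PMF.mem_support_map_iff]
  rintro ⟨ω, -, hω⟩
  exact h ω hω

theorem isMarkov_map_of_factor {μ : PMF (ζ₁ × ζ₂ × ζ₃)} (u : ζ₁ → ζ₂ → ℝ≥0∞)
    (v : ζ₂ → ζ₃ → ℝ≥0∞) (h : ∀ a b c, μ (a, b, c) = u a b * v b c) (f : ζ₁ → ζ₁')
    (g : ζ₃ → ζ₃') : IsMarkov (μ.map fun t => (f t.1, t.2.1, g t.2.2)) := by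
  classical
  refine isMarkov_of_factor (fun a' b => ∑' a, if a' = f a then u a b else 0)
    (fun b c' => ∑' c, if c' = g c then v b c else 0) fun a' b c' => ?_
  rw [PMF.map_apply, ENNReal.tsum_prod', ← ENNReal.tsum_mul_right]
  refine tsum_congr fun a => ?_
  rw [ENNReal.tsum_prod', tsum_eq_single b, ← ENNReal.tsum_mul_left]
  · refine tsum_congr fun c => ?_
    simp only [Prod.mk.injEq, true_and, h]
    split_ifs <;> simp_all
  · intro b' hb
    simp [hb.symm]

theorem bind_map_pair_apply (p : PMF Ω) (k : Ω → PMF Ω') (ω : Ω) (r : Ω') :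
    (p.bind fun ω => (k ω).map fun r => (ω, r)) (ω, r) = p ω * k ω r := by
  rw [PMF.bind_apply, tsum_eq_single ω]
  · congr 1
    exact map_apply_of_injective _ (f := fun r => (ω, r)) (fun r r' h => by simpa using h) r
  · intro ω' h
    rw [map_apply_eq_zero _ fun r h' => h (Prod.mk.inj h').1, mul_zero]

theorem bind_map_pair_fst (p : PMF Ω) (k : Ω → PMF Ω') :
    (p.bind fun ω => (k ω).map fun r => (ω, r)).map Prod.fst = p := by
  rw [PMF.map_bind]
  refine Eq.trans ?_ (PMF.bind_pure p)
  congr 1; ext1 ω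
  rw [PMF.map_comp]
  exact PMF.map_const (k ω) ω

end factor

section mutualInfo

variable {Ω α β α' β' ζ ζ' ζ'' : Type*} [Fintype α] [Fintype β']

theorem condEntropy_eq_of_map_eq {Ω' : Type*} {μ : PMF Ω} {ν : PMF Ω'} {f : Ω → Ω'}
    (h : μ.map f = ν) (F : Ω' → α) (Z : Ω' → ζ) :
    condEntropy ν F Z = condEntropy μ (fun ω => F (f ω)) fun ω => Z (f ω) := by
  rw [← h, condEntropy_map]

/-- A message computed from `G` and `Z` does not increase `I(F;G|Z)`. -/
theorem mutualInfo_message_le {μ : PMF Ω} {F : Ω → α} {G : Ω → β} {Z : Ω → ζ} {W : Ω → ζ'}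
    (h : IsMarkov (μ.map fun ω => (F ω, (G ω, Z ω), W ω))) :
    condEntropy μ F (fun ω => (W ω, Z ω)) - condEntropy μ F (fun ω => (G ω, W ω, Z ω))
      ≤ condEntropy μ F Z - condEntropy μ F fun ω => (G ω, Z ω) := by
  -- Given `(G, Z)` the message `W` says nothing about `F`, so the subtracted term is unchanged,
  -- while conditioning on `W` can only lower the first one.
  have h1 := condEntropy_of_isMarkov h
  have h2 : condEntropy μ F (fun ω => ((G ω, Z ω), W ω))
      = condEntropy μ F (fun ω => (G ω, W ω, Z ω)) :=
    condEntropy_eq_of_determined fun ω _ ω' _ => by simp only [Prod.mk.injEq]; tauto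
  have h3 := condEntropy_le_of_map (μ := μ) (F := F) (Z := fun ω => (W ω, Z ω)) Prod.snd
  linarith

/-- The data processing inequality: `I(F';G'|Z) ≤ I(F;G|Z)` if `F'` and `G'` are computed
locally. -/
theorem mutualInfo_processing_le {μ : PMF Ω} {F : Ω → α} {G : Ω → β} {F' : Ω → α'} {G' : Ω → β'}
    {Z : Ω → ζ} (h1 : IsMarkov (μ.map fun ω => (G' ω, (F ω, Z ω), F' ω)))
    (h2 : IsMarkov (μ.map fun ω => (F ω, (G ω, Z ω), G' ω))) :
    condEntropy μ G' Z - condEntropy μ G' (fun ω => (F' ω, Z ω))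
      ≤ condEntropy μ F Z - condEntropy μ F fun ω => (G ω, Z ω) := by
  -- Through the intermediate quantity `I(F;G'|Z)`: replacing `F'` by `F`, then `G'` by `G`,
  -- increases the information. Each time the Markov chain allows the derived variable to be added
  -- to the condition for free.
  have e1 := condEntropy_of_isMarkov h1
  have e2 := condEntropy_of_isMarkov h2
  have e3 : condEntropy μ G' (fun ω => ((F ω, Z ω), F' ω))
      ≤ condEntropy μ G' (fun ω => (F' ω, Z ω)) :=
    condEntropy_le_of_comp (fun t => (t.2, t.1.2)) fun _ _ => rfl
  have e4 : condEntropy μ F (fun ω => ((G ω, Z ω), G' ω))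
      ≤ condEntropy μ F (fun ω => (G' ω, Z ω)) :=
    condEntropy_le_of_comp (fun t => (t.2, t.1.2)) fun _ _ => rfl
  have e5 := condEntropy_comm μ F G' Z
  linarith

/-- `I(G;Z|A) ≤ I(S;W|A)` if `Z` is a function of `S` and `A`, and `G` and `A` are functions
of `W`. -/
theorem mutualInfo_le_of_determined [Fintype β] {μ : PMF Ω} {G : Ω → α} {S : Ω → β} {A : Ω → ζ}
    {Z : Ω → ζ'} {W : Ω → ζ''}
    (hZ : ∀ ω ∈ μ.support, ∀ ω' ∈ μ.support, (S ω, A ω) = (S ω', A ω') → Z ω = Z ω')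
    (hW : ∀ ω ∈ μ.support, ∀ ω' ∈ μ.support, W ω = W ω' → (G ω, A ω) = (G ω', A ω')) :
    condEntropy μ G A - condEntropy μ G Z ≤ condEntropy μ S A - condEntropy μ S W := by
  -- Through the symmetric quantity `I(G;S|A)`: the first bound replaces `Z` by `(S, A)`, the second
  -- `(G, A)` by `W`.
  have h1 := condEntropy_le_of_determined (F := G) hZ
  have h2 := condEntropy_le_of_determined (F := S) hW
  have h3 := condEntropy_comm μ G S A
  linarith

end mutualInfo

namespace Protocol

variable {X Y U V Q : Type*} (π : Protocol X Y U V)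

/-- In the product form of the law, `J` involves Bob's set up, which is part of his view, and
Alice's set up, which is in the condition. So `J` joins Bob's factor, and Alice's factor is left
alone. -/
theorem isMarkov_viewB_viewA (J : PMF (X × Y × Q)) (n : ℕ) {ζ₁ ζ₃ : Type*} (f : π.ViewB → ζ₁)
    (g : π.ViewA → ζ₃) : IsMarkov ((π.tracedRun J n).map fun ω =>
      (f ω.2.2.2, (ω.2.2.1.setup, ω.1, ω.2.1), g ω.2.2.1)) := by
  classical
  have := isMarkov_map_of_factor (μ := (π.tracedRun J n).map fun ω =>
      (ω.2.2.2, (ω.2.2.1.setup, ω.1, ω.2.1), ω.2.2.1))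
    (fun b z => J (z.1, b.setup, z.2.1) * partyWeight π.bob false n z.2.2 b)
    (fun z a => if a.setup = z.1 then partyWeight π.alice true n z.2.2 a else 0) ?_ f g
  · rwa [PMF.map_comp] at this
  rintro b ⟨x, q, t⟩ a
  split_ifs with h
  · subst h
    refine (map_apply_of_injective _ ?_ (q, t, a, b)).trans ?_
    · rintro ⟨q, t, a, b⟩ ⟨q', t', a', b'⟩ h; simp_all
    · rw [tracedRun_apply]; ring
  · rw [mul_zero]
    refine map_apply_eq_zero _ ?_
    rintro ⟨q', t', a', b'⟩ h'
    simp only [Prod.mk.injEq] at h'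
    exact h (h'.2.2 ▸ h'.2.1.1)

theorem isMarkov_viewA_viewB (J : PMF (X × Y × Q)) (n : ℕ) {ζ₁ ζ₃ : Type*} (f : π.ViewA → ζ₁)
    (g : π.ViewB → ζ₃) : IsMarkov ((π.tracedRun J n).map fun ω =>
      (f ω.2.2.1, (ω.2.2.2.setup, ω.1, ω.2.1), g ω.2.2.2)) := by
  classical
  have := isMarkov_map_of_factor (μ := (π.tracedRun J n).map fun ω =>
      (ω.2.2.1, (ω.2.2.2.setup, ω.1, ω.2.1), ω.2.2.2))
    (fun a z => J (a.setup, z.1, z.2.1) * partyWeight π.alice true n z.2.2 a)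
    (fun z b => if b.setup = z.1 then partyWeight π.bob false n z.2.2 b else 0) ?_ f g
  · rwa [PMF.map_comp] at this
  rintro a ⟨y, q, t⟩ b
  split_ifs with h
  · subst h
    refine (map_apply_of_injective _ ?_ (q, t, a, b)).trans ?_
    · rintro ⟨q, t, a, b⟩ ⟨q', t', a', b'⟩ h; simp_all
    · rw [tracedRun_apply]; ring
  · rw [mul_zero]
    refine map_apply_eq_zero _ ?_
    rintro ⟨q', t', a', b'⟩ h'
    simp only [Prod.mk.injEq] at h'
    exact h (h'.2.2 ▸ h'.2.1.1)

/-- The message is drawn from Alice's view, whose factor is independent of Bob's given her set up,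
the side information and the transcript. -/
theorem isMarkov_moveA (J : PMF (X × Y × Q)) (n : ℕ) :
    IsMarkov (((π.tracedRun J n).bind fun ω => (ω.2.2.1.turn π.alice).map fun r => (ω, r)).map
      fun s => (s.1.2.2.2.setup, (s.1.2.2.1.setup, s.1.1, s.1.2.1), s.2.2)) := by
  classical
  have := isMarkov_map_of_factor (μ := ((π.tracedRun J n).bind fun ω =>
      (ω.2.2.1.turn π.alice).map fun r => (ω, r)).map
      fun s => (s.1.2.2.2, (s.1.2.2.1.setup, s.1.1, s.1.2.1), s.1.2.2.1, s.2))
    (fun b z => J (z.1, b.setup, z.2.1) * partyWeight π.bob false n z.2.2 b)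
    (fun z c => if c.1.setup = z.1 then
      partyWeight π.alice true n z.2.2 c.1 * c.1.turn π.alice c.2 else 0) ?_
    (fun b => b.setup) (fun c => c.2.2)
  · rwa [PMF.map_comp] at this
  rintro b ⟨x, q, t⟩ ⟨a, r⟩
  split_ifs with h
  · subst h
    refine (map_apply_of_injective _ ?_ ((q, t, a, b), r)).trans ?_
    · rintro ⟨⟨q, t, a, b⟩, r⟩ ⟨⟨q', t', a', b'⟩, r'⟩ h; simp_all
    · rw [bind_map_pair_apply, tracedRun_apply]; ring
  · rw [mul_zero]
    refine map_apply_eq_zero _ ?_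
    rintro ⟨⟨q', t', a', b'⟩, r'⟩ h'
    simp only [Prod.mk.injEq] at h'
    exact h (h'.2.2.1 ▸ h'.2.1.1)

theorem isMarkov_moveB (J : PMF (X × Y × Q)) (n : ℕ) :
    IsMarkov (((π.tracedRun J n).bind fun ω => (ω.2.2.2.turn π.bob).map fun r => (ω, r)).map
      fun s => (s.1.2.2.1.setup, (s.1.2.2.2.setup, s.1.1, s.1.2.1), s.2.2)) := by
  classical
  have := isMarkov_map_of_factor (μ := ((π.tracedRun J n).bind fun ω =>
      (ω.2.2.2.turn π.bob).map fun r => (ω, r)).map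
      fun s => (s.1.2.2.1, (s.1.2.2.2.setup, s.1.1, s.1.2.1), s.1.2.2.2, s.2))
    (fun a z => J (a.setup, z.1, z.2.1) * partyWeight π.alice true n z.2.2 a)
    (fun z c => if c.1.setup = z.1 then
      partyWeight π.bob false n z.2.2 c.1 * c.1.turn π.bob c.2 else 0) ?_
    (fun a => a.setup) (fun c => c.2.2)
  · rwa [PMF.map_comp] at this
  rintro a ⟨y, q, t⟩ ⟨b, r⟩
  split_ifs with h
  · subst h
    refine (map_apply_of_injective _ ?_ ((q, t, a, b), r)).trans ?_
    · rintro ⟨⟨q, t, a, b⟩, r⟩ ⟨⟨q', t', a', b'⟩, r'⟩ h; simp_all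
    · rw [bind_map_pair_apply, tracedRun_apply]; ring
  · rw [mul_zero]
    refine map_apply_eq_zero _ ?_
    rintro ⟨⟨q', t', a', b'⟩, r'⟩ h'
    simp only [Prod.mk.injEq] at h'
    exact h (h'.2.2.1 ▸ h'.2.1.1)

/-- The parties never see `Q`: it enters the law through `J` only. -/
theorem isMarkov_sideInfo (J : PMF (X × Y × Q)) (n : ℕ) :
    IsMarkov ((π.tracedRun J n).map fun ω =>
      (ω.1, (ω.2.2.1.setup, ω.2.2.2.setup), ω.2.2)) := by
  classical
  have := isMarkov_map_of_factor (μ := (π.tracedRun J n).map fun ω =>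
      (ω.1, (ω.2.2.1.setup, ω.2.2.2.setup), ω.2))
    (fun q z => J (z.1, z.2, q))
    (fun z c => if (c.2.1.setup, c.2.2.setup) = z then
      partyWeight π.alice true n c.1 c.2.1 * partyWeight π.bob false n c.1 c.2.2 else 0) ?_
    id (fun c => c.2)
  · rwa [PMF.map_comp] at this
  rintro q ⟨x, y⟩ ⟨t, a, b⟩
  split_ifs with h
  · obtain ⟨rfl, rfl⟩ := Prod.mk.inj h
    refine (map_apply_of_injective _ ?_ (q, t, a, b)).trans ?_
    · rintro ⟨q, t, a, b⟩ ⟨q', t', a', b'⟩ h; simp_all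
    · rw [tracedRun_apply]
  · rw [mul_zero]
    refine map_apply_eq_zero _ ?_
    rintro ⟨q', t', a', b'⟩ h'
    simp only [Prod.mk.injEq] at h' h
    exact h ⟨h'.2.2.2.1 ▸ h'.2.1.1, h'.2.2.2.2 ▸ h'.2.1.2⟩

section inequalities

variable [Fintype X] [Fintype Y]

/-- The mutual information of the set up, given the transcript and the side information. -/
def transcriptInfo (J : PMF (X × Y × Q)) (n : ℕ) : ℝ :=
  condEntropy (π.tracedRun J n) (fun ω => ω.2.2.1.setup) (fun ω => (ω.1, ω.2.1))
    - condEntropy (π.tracedRun J n) (fun ω => ω.2.2.1.setup)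
        fun ω => (ω.2.2.2.setup, ω.1, ω.2.1)

/-- Symmetry of mutual information. In a turn of Alice the entropy has to be that of Bob's set up,
in a turn of Bob that of Alice's. -/
theorem transcriptInfo_eq (J : PMF (X × Y × Q)) (n : ℕ) : π.transcriptInfo J n =
    condEntropy (π.tracedRun J n) (fun ω => ω.2.2.2.setup) (fun ω => (ω.1, ω.2.1))
    - condEntropy (π.tracedRun J n) (fun ω => ω.2.2.2.setup)
        fun ω => (ω.2.2.1.setup, ω.1, ω.2.1) := by
  have := condEntropy_comm (π.tracedRun J n) (fun ω => ω.2.2.1.setup)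
    (fun ω => ω.2.2.2.setup) (fun ω => (ω.1, ω.2.1))
  unfold transcriptInfo
  linarith

/-- The mover's message is a randomised function of its own view alone, so adding it to the
transcript creates no dependence between the set ups. -/
theorem transcriptInfo_succ_le (J : PMF (X × Y × Q)) (n : ℕ) :
    π.transcriptInfo J (n + 1) ≤ π.transcriptInfo J n := by
  by_cases hn : Even n
  · rw [transcriptInfo_eq, transcriptInfo_eq]
    -- The run up to turn `n` joined with the outcome of the next move. Both the old and the new run
    -- are images of it, so their entropies live on one space.
    set σ := (π.tracedRun J n).bind fun ω => (ω.2.2.1.turn π.alice).map fun r => (ω, r) with hσ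
    have h1 : π.tracedRun J n = σ.map Prod.fst := (bind_map_pair_fst _ _).symm
    have h2 : π.tracedRun J (n + 1)
        = σ.map fun s => (s.1.1, s.2.2 :: s.1.2.1, s.2.1, s.1.2.2.2.receive s.2.2) := by
      rw [tracedRun, hσ, PMF.map_bind]
      congr 1; ext1 ω
      rw [PMF.map_comp, tracedStep, if_pos hn]; rfl
    have hsup : ∀ s ∈ σ.support, s.2.1.setup = s.1.2.2.1.setup := by
      rintro ⟨ω, r⟩ h
      rw [PMF.mem_support_iff, hσ, bind_map_pair_apply] at h
      exact View.setup_turn (right_ne_zero_of_mul h)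
    have hm := mutualInfo_message_le (π.isMarkov_moveA J n)
    rw [h2, condEntropy_map, condEntropy_map, h1, condEntropy_map, condEntropy_map]
    simp only [View.setup_receive]
    refine le_trans (le_of_eq ?_) hm
    congr 1 <;> refine condEntropy_eq_of_determined fun s hs s' hs' => ?_
    · simp only [Prod.mk.injEq, List.cons.injEq]; tauto
    · rw [hsup s hs, hsup s' hs']
      simp only [Prod.mk.injEq, List.cons.injEq]; tauto
  · unfold transcriptInfo
    set σ := (π.tracedRun J n).bind fun ω => (ω.2.2.2.turn π.bob).map fun r => (ω, r) with hσ
    have h1 : π.tracedRun J n = σ.map Prod.fst := (bind_map_pair_fst _ _).symm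
    have h2 : π.tracedRun J (n + 1)
        = σ.map fun s => (s.1.1, s.2.2 :: s.1.2.1, s.1.2.2.1.receive s.2.2, s.2.1) := by
      rw [tracedRun, hσ, PMF.map_bind]
      congr 1; ext1 ω
      rw [PMF.map_comp, tracedStep, if_neg hn]; rfl
    have hsup : ∀ s ∈ σ.support, s.2.1.setup = s.1.2.2.2.setup := by
      rintro ⟨ω, r⟩ h
      rw [PMF.mem_support_iff, hσ, bind_map_pair_apply] at h
      exact View.setup_turn (right_ne_zero_of_mul h)
    have hm := mutualInfo_message_le (π.isMarkov_moveB J n)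
    rw [h2, condEntropy_map, condEntropy_map, h1, condEntropy_map, condEntropy_map]
    simp only [View.setup_receive]
    refine le_trans (le_of_eq ?_) hm
    congr 1 <;> refine condEntropy_eq_of_determined fun s hs s' hs' => ?_
    · simp only [Prod.mk.injEq, List.cons.injEq]; tauto
    · rw [hsup s hs, hsup s' hs']
      simp only [Prod.mk.injEq, List.cons.injEq]; tauto

theorem transcriptInfo_le (J : PMF (X × Y × Q)) (n : ℕ) : π.transcriptInfo J n
    ≤ condEntropy J (fun w => w.1) (fun w => w.2.2)
      - condEntropy J (fun w => w.1) fun w => w.2 := by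
  induction n with
  | zero =>
    unfold transcriptInfo
    rw [tracedRun, condEntropy_map, condEntropy_map]
    refine le_of_eq ?_
    congr 1 <;> exact condEntropy_eq_of_determined fun s hs s' hs' => by
      simp [Prod.ext_iff]
  | succ n ih => exact (π.transcriptInfo_succ_le J n).trans ih

variable {U' V' : Type*} [Fintype V']

/-- `I(A;B|Q,T) ≤ I(X;Y|Q)` for functions `A`, `B` of the views, where `T` is the transcript. -/
theorem outputInfo_le (J : PMF (X × Y × Q)) (n : ℕ) (f : π.ViewA → U') (g : π.ViewB → V') :
    condEntropy (π.tracedRun J n) (fun ω => g ω.2.2.2) (fun ω => (ω.1, ω.2.1))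
      - condEntropy (π.tracedRun J n) (fun ω => g ω.2.2.2) (fun ω => (f ω.2.2.1, ω.1, ω.2.1))
    ≤ condEntropy J (fun w => w.1) (fun w => w.2.2) - condEntropy J (fun w => w.1) fun w => w.2 :=
  (mutualInfo_processing_le (π.isMarkov_viewB_viewA J n g f)
    (π.isMarkov_viewA_viewB J n _ g)).trans (π.transcriptInfo_le J n)

end inequalities

section leakage

variable {U' V' : Type*} [Fintype Q]

/-- `H(B|A) - H(B|Q,T,f(A)) ≤ I(Y;Q|X)` for a function `B` of Bob's view, where `A` is Alice's
view and `T` is the transcript. -/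
theorem leakA_le [Fintype V'] (J : PMF (X × Y × Q)) (n : ℕ) {ζ : Type*}
    (f : π.ViewA → ζ) (g : π.ViewB → V') :
    condEntropy (π.tracedRun J n) (fun ω => g ω.2.2.2) (fun ω => ω.2.2.1)
      - condEntropy (π.tracedRun J n) (fun ω => g ω.2.2.2) (fun ω => (f ω.2.2.1, ω.1, ω.2.1))
    ≤ condEntropy J (fun w => w.2.2) (fun w => w.1)
      - condEntropy J (fun w => w.2.2) fun w => (w.2.1, w.1) := by
  -- Given Alice's view, `(f(A), Q, T)` is a function of `Q`, so it tells about Bob's view no more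
  -- than `Q` shares with set up and views. Then `H(Q|A) ≤ H(Q|X)` since the view contains the set
  -- up, and the views add nothing about `Q` to `(X, Y)`.
  have h := mutualInfo_le_of_determined (μ := π.tracedRun J n) (G := fun ω => g ω.2.2.2)
    (S := fun ω => ω.1) (A := fun ω => ω.2.2.1) (Z := fun ω => (f ω.2.2.1, ω.1, ω.2.1))
    (W := fun ω => ((ω.2.2.1.setup, ω.2.2.2.setup), ω.2.2))
    (fun ω h ω' h' e => by
      simp only [Prod.mk.injEq] at e ⊢
      exact ⟨by rw [e.2], e.1, π.transcript_eq_of_viewA_eq h h' e.2⟩)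
    (fun ω h ω' h' e => by
      simp only [Prod.mk.injEq] at e ⊢
      exact ⟨by rw [e.2], by rw [e.2]⟩)
  have h3 : condEntropy (π.tracedRun J n) (fun ω => ω.1) (fun ω => ω.2.2.1)
      ≤ condEntropy J (fun w => w.2.2) (fun w => w.1) := by
    rw [condEntropy_eq_of_map_eq (π.tracedRun_map_setup J n)]
    exact condEntropy_le_of_comp View.setup fun _ _ => rfl
  have h4 : condEntropy J (fun w => w.2.2) (fun w => (w.2.1, w.1))
      = condEntropy (π.tracedRun J n) (fun ω => ω.1)
        fun ω => ((ω.2.2.1.setup, ω.2.2.2.setup), ω.2.2) := by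
    rw [condEntropy_of_isMarkov (π.isMarkov_sideInfo J n)]
    rw [condEntropy_eq_of_map_eq (π.tracedRun_map_setup J n)]
    exact condEntropy_eq_of_determined fun ω _ ω' _ => by
      simp only [Prod.mk.injEq]; tauto
  linarith

/-- `H(A|B) - H(A|Q,T,g(B)) ≤ I(X;Q|Y)` for a function `A` of Alice's view, where `B` is Bob's
view and `T` is the transcript. -/
theorem leakB_le [Fintype U'] (J : PMF (X × Y × Q)) (n : ℕ) {ζ : Type*}
    (f : π.ViewA → U') (g : π.ViewB → ζ) :
    condEntropy (π.tracedRun J n) (fun ω => f ω.2.2.1) (fun ω => ω.2.2.2)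
      - condEntropy (π.tracedRun J n) (fun ω => f ω.2.2.1) (fun ω => (g ω.2.2.2, ω.1, ω.2.1))
    ≤ condEntropy J (fun w => w.2.2) (fun w => w.2.1)
      - condEntropy J (fun w => w.2.2) fun w => (w.1, w.2.1) := by
  have h := mutualInfo_le_of_determined (μ := π.tracedRun J n) (G := fun ω => f ω.2.2.1)
    (S := fun ω => ω.1) (A := fun ω => ω.2.2.2) (Z := fun ω => (g ω.2.2.2, ω.1, ω.2.1))
    (W := fun ω => ((ω.2.2.1.setup, ω.2.2.2.setup), ω.2.2))
    (fun ω h ω' h' e => by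
      simp only [Prod.mk.injEq] at e ⊢
      exact ⟨by rw [e.2], e.1, π.transcript_eq_of_viewB_eq h h' e.2⟩)
    (fun ω h ω' h' e => by
      simp only [Prod.mk.injEq] at e ⊢
      exact ⟨by rw [e.2], by rw [e.2]⟩)
  have h3 : condEntropy (π.tracedRun J n) (fun ω => ω.1) (fun ω => ω.2.2.2)
      ≤ condEntropy J (fun w => w.2.2) (fun w => w.2.1) := by
    rw [condEntropy_eq_of_map_eq (π.tracedRun_map_setup J n)]
    exact condEntropy_le_of_comp View.setup fun _ _ => rfl
  have h4 : condEntropy J (fun w => w.2.2) (fun w => (w.1, w.2.1))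
      = condEntropy (π.tracedRun J n) (fun ω => ω.1)
        fun ω => ((ω.2.2.1.setup, ω.2.2.2.setup), ω.2.2) := by
    rw [condEntropy_eq_of_map_eq (π.tracedRun_map_setup J n)]
    exact (condEntropy_of_isMarkov (π.isMarkov_sideInfo J n)).symm
  linarith

end leakage

end Protocol

/-! ### Tension given side information with an arbitrary alphabet -/

/-- The tension, in nats, given side information with an arbitrary alphabet. -/
def natTension {U V T : Type*} [Fintype U] [Fintype V] (ν : PMF (U × V × T)) : ℝ × ℝ × ℝ :=
  (condEntropy ν (fun t => t.2.1) (fun t => t.1)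
      - condEntropy ν (fun t => t.2.1) (fun t => (t.1, t.2.2)),
   condEntropy ν (fun t => t.1) (fun t => t.2.1)
      - condEntropy ν (fun t => t.1) (fun t => t.2),
   condEntropy ν (fun t => t.2.1) (fun t => t.2.2)
      - condEntropy ν (fun t => t.2.1) (fun t => (t.1, t.2.2)))

section jointLaw

variable {X Y Q : Type*}

theorem natTension_jointLaw [Fintype X] [Fintype Y] [Fintype Q] (P : PMF (X × Y))
    (K : X × Y → PMF Q) : natTension (jointLaw P K) = Real.log 2 • tension P K := by
  unfold natTension tension
  simp only [Prod.smul_mk, smul_eq_mul, mul_comm (Real.log 2)]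
  refine congrArg₂ Prod.mk ?_ (congrArg₂ Prod.mk ?_ ?_)
  · rw [condMutualInfo_mul_log_two]
    congr 1
    exact condEntropy_eq_of_determined fun ω _ ω' _ => by simp only [Prod.mk.injEq]; tauto
  · rw [condMutualInfo_mul_log_two]
    congr 1
    exact condEntropy_eq_of_determined fun ω _ ω' _ => by simp only [Prod.ext_iff]; tauto
  · rw [condMutualInfo_mul_log_two']

/-- Disintegration of a joint law. -/
theorem exists_jointLaw_eq (μ : PMF (X × Y × Q)) :
    ∃ K : X × Y → PMF Q, μ = jointLaw (μ.map fun t => (t.1, t.2.1)) K := by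
  classical
  set p := μ.map fun t => (t.1, t.2.1) with hp
  have hsum : ∀ w : X × Y, p w = ∑' q, μ (w.1, w.2, q) := by
    intro w
    have : p = (μ.map (Equiv.prodAssoc X Y Q).symm).map Prod.fst := by rw [hp, PMF.map_comp]; rfl
    rw [this, map_fst_apply]
    exact tsum_congr fun q =>
      map_apply_of_injective μ (Equiv.prodAssoc X Y Q).symm.injective (w.1, w.2, q)
  obtain ⟨t₀, -⟩ := μ.support_nonempty
  -- Where the pair has probability zero the conditional law is arbitrary.
  refine ⟨fun w => if h : p w = 0 then PMF.pure t₀.2.2 else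
    PMF.normalize (fun q => μ (w.1, w.2, q)) (hsum w ▸ h) (hsum w ▸ p.apply_ne_top w), ?_⟩
  ext ⟨x, y, q⟩
  rw [jointLaw_apply]
  split_ifs with h
  · rw [h, zero_mul]
    have := hsum (x, y)
    rw [h] at this
    exact ENNReal.tsum_eq_zero.1 this.symm q
  · rw [PMF.normalize_apply, ← hsum (x, y), mul_comm, mul_assoc,
      ENNReal.inv_mul_cancel h (p.apply_ne_top _), mul_one]

/-- Both joint laws dominate the overlap of `p` and `p'` extended by the common kernel `K`. -/
theorem tvDist_jointLaw_le (p p' : PMF (X × Y)) (K : X × Y → PMF Q) :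
    tvDist (jointLaw p K) (jointLaw p' K) ≤ tvDist p p' := by
  refine (tvDist_le_of_le (m := fun t => min (p (t.1, t.2.1)) (p' (t.1, t.2.1)) *
    K (t.1, t.2.1) t.2.2) ?_ ?_).trans ?_
  · rintro ⟨x, y, q⟩
    rw [jointLaw_apply]; gcongr; exact min_le_left _ _
  · rintro ⟨x, y, q⟩
    rw [jointLaw_apply]; gcongr; exact min_le_right _ _
  · have h1 : ∑' t : X × Y × Q, min (p (t.1, t.2.1)) (p' (t.1, t.2.1)) * K (t.1, t.2.1) t.2.2
        = ∑' w, min (p w) (p' w) := by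
      simp only [ENNReal.tsum_prod', ENNReal.tsum_mul_left, PMF.tsum_coe, mul_one]
    have h2 := (hasSum_min p p').tsum_eq
    have h3 : (∑' w, min (p w) (p' w)).toReal = 1 - tvDist p p' := by
      rw [← h2, ENNReal.tsum_toReal_eq fun w => ne_top_of_le_ne_top (p.apply_ne_top w)
        (min_le_left _ _)]
      exact tsum_congr fun w => ENNReal.toReal_min (p.apply_ne_top w) (p'.apply_ne_top w)
    rw [h1, h3]
    linarith

end jointLaw

theorem entropyModulus_mono {k l : ℕ} {ε : ℝ} (hk : 0 < k) (h : k ≤ l) (hε : 0 ≤ ε) :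
    entropyModulus k ε ≤ entropyModulus l ε := by
  unfold entropyModulus
  gcongr

theorem tvDist_map_le_two_mul {Ω β : Type*} {p q : PMF Ω} {r : PMF β} {f : Ω → β} {ε : ℝ}
    (h : tvDist r (p.map f) ≤ ε) (hpq : tvDist p q ≤ ε) : tvDist r (q.map f) ≤ 2 * ε :=
  (tvDist_triangle _ _ _).trans
    ((add_le_add h ((tvDist_map_le _ _ f).trans hpq)).trans (two_mul ε).ge)

/-- The conditional entropy of images of two nearby laws. -/
theorem condEntropy_le_of_tvDist_le {Ω Ω₁ Ω₂ α ζ : Type*} [Fintype α] {μ : PMF Ω₁} {ν : PMF Ω₂}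
    {f : Ω₁ → Ω} {g : Ω₂ → Ω} {F : Ω → α} {Z : Ω → ζ} {ε : ℝ}
    (h : tvDist (ν.map g) (μ.map f) ≤ ε) (hε : ε ≤ 1 / 2) :
    condEntropy ν (fun ω => F (g ω)) (fun ω => Z (g ω))
      ≤ condEntropy μ (fun ω => F (f ω)) (fun ω => Z (f ω))
        + entropyModulus (Fintype.card α) ε := by
  rw [← condEntropy_map ν g F Z, ← condEntropy_map μ f F Z]
  exact condEntropy_le_add_entropyModulus
    ((tvDist_map_le _ _ fun ω => (F ω, Z ω)).trans h) hε

theorem bind_map_const {Ω α β : Type*} (p : PMF Ω) (k : Ω → PMF α) (f : Ω → α → β) (g : β → Ω)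
    (h : ∀ ω a, g (f ω a) = ω) : (p.bind fun ω => (k ω).map (f ω)).map g = p := by
  rw [PMF.map_bind]
  refine Eq.trans ?_ (PMF.bind_pure p)
  congr 1; ext1 ω
  rw [PMF.map_comp, show g ∘ f ω = Function.const α ω from funext (h ω), PMF.map_const]

/-! ### From a secure protocol to side information about its outputs -/

namespace Protocol

variable {X Y U V : Type*} (π : Protocol X Y U V)

/-- After enough turns the law of the views is close to that of the final views. -/
theorem exists_tvDist_run_le {P : PMF (X × Y)} (h : π.Valid P) {ε : ℝ} (hε : 0 < ε) :
    ∃ n, tvDist (π.finalLaw h) (π.run P n) ≤ ε := by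
  have h1 : Tendsto (fun n => (∑' c, π.doneMass P n c).toReal) atTop (𝓝 1) := by
    have := (ENNReal.tendsto_toReal ENNReal.one_ne_top).comp h
    exact this
  obtain ⟨n, hn⟩ := (h1.eventually (lt_mem_nhds (show 1 - ε < 1 by linarith))).exists
  -- The mass that has terminated by turn `n` lies below both laws, and its total tends to one.
  refine ⟨n, (tvDist_le_of_le (m := π.doneMass P n) (fun c => ?_) fun c => ?_).trans
    (by linarith)⟩
  · exact le_iSup (fun n => π.doneMass P n c) n
  · exact Set.indicator_le_self _ _ _

/-- If a pair with law `R` is securely sampled, then side information about the set up is turned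
into side information about the pair, and the tension hardly increases. -/
theorem SecurelySamples.exists_natTension_le {π : Protocol X Y U V} {Q : Type*} [Fintype X]
    [Fintype Y] [Fintype U] [Fintype V] [Fintype Q] {ε : ℝ} {P : PMF (X × Y)} {R : PMF (U × V)}
    (h : π.SecurelySamples ε P R) (hε : 0 < ε) (hε' : 2 * ε ≤ 1 / 2) (K : X × Y → PMF Q) :
    ∃ κ : U × V → PMF (Q × List (Option π.M)), natTension (jointLaw R κ)
      ≤ Real.log 2 • tension P K
        + (2 * entropyModulus (Fintype.card U * Fintype.card V) (2 * ε)) • (1, 1, 1) := by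
  classical
  obtain ⟨hv, σA, σB, hA, hB, d1, d2, d3⟩ := h
  set simA : PMF (π.ViewA × U × V) := R.bind fun w => (σA w).map fun s => (s, w.1, w.2) with hsimA
  set simB : PMF (U × V × π.ViewB) := R.bind fun w => (σB w).map fun s => (w.1, w.2, s) with hsimB
  -- Stopping after finitely many turns costs another `ε`; this is why `2 * ε` appears from here on.
  obtain ⟨n, hn⟩ := π.exists_tvDist_run_le hv hε
  obtain ⟨w₀, -⟩ := R.support_nonempty
  -- A party that has not terminated is given an arbitrary output.
  set oA : π.ViewA → U := fun a => a.output.getD w₀.1 with hoA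
  set oB : π.ViewB → V := fun b => b.output.getD w₀.2 with hoB
  rw [← natTension_jointLaw]
  set J := jointLaw P K with hJ
  set μ := π.tracedRun J n with hμ
  have hrun : μ.map (fun ω => ω.2.2) = π.run P n := π.tracedRun_map_config P K n
  rw [← hrun] at hn
  have e1 : tvDist R (μ.map fun ω => (oA ω.2.2.1, oB ω.2.2.2)) ≤ 2 * ε := by
    have := (tvDist_map_le _ _ fun t : Option U × Option V =>
      (t.1.getD w₀.1, t.2.getD w₀.2)).trans d1
    rw [PMF.map_comp, PMF.map_comp] at this
    have := tvDist_map_le_two_mul this hn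
    have hR : R.map ((fun t : Option U × Option V => (t.1.getD w₀.1, t.2.getD w₀.2)) ∘
        fun w => (some w.1, some w.2)) = R := PMF.map_id R
    rw [PMF.map_comp, hR] at this
    exact this
  have e2 : tvDist (simA.map fun t => (t.1, t.2.2)) (μ.map fun ω => (ω.2.2.1, oB ω.2.2.2))
      ≤ 2 * ε := by
    have := (tvDist_map_le _ _ fun t : π.ViewA × Option V => (t.1, t.2.getD w₀.2)).trans d2
    rw [PMF.map_comp, PMF.map_comp] at this
    have := tvDist_map_le_two_mul this hn
    rw [PMF.map_comp] at this
    exact this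
  have e3 : tvDist (simB.map fun t => (t.1, t.2.2)) (μ.map fun ω => (oA ω.2.2.1, ω.2.2.2))
      ≤ 2 * ε := by
    have := (tvDist_map_le _ _ fun t : Option U × π.ViewB => (t.1.getD w₀.1, t.2)).trans d3
    rw [PMF.map_comp, PMF.map_comp] at this
    have := tvDist_map_le_two_mul this hn
    rw [PMF.map_comp] at this
    exact this
  -- The new side information is `(Q, T)`. Its conditional law given the actual outputs is applied
  -- to `R`, so the pair has law exactly `R` and the joint law is still close to the actual one.
  obtain ⟨κ, hκ⟩ := exists_jointLaw_eq
    (μ.map fun ω => (oA ω.2.2.1, oB ω.2.2.2, ω.1, ω.2.1))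
  rw [PMF.map_comp] at hκ
  have e4 : tvDist ((jointLaw R κ).map id)
      (μ.map fun ω => (oA ω.2.2.1, oB ω.2.2.2, ω.1, ω.2.1)) ≤ 2 * ε := by
    rw [hκ, PMF.map_id]
    exact (tvDist_jointLaw_le _ _ κ).trans e1
  have e4' := e4
  rw [tvDist_comm] at e4'
  refine ⟨κ, ?_⟩
  have hcU : 0 < Fintype.card U := Fintype.card_pos_iff.2 ⟨w₀.1⟩
  have hcV : 0 < Fintype.card V := Fintype.card_pos_iff.2 ⟨w₀.2⟩
  have hMU := entropyModulus_mono hcU (Nat.le_mul_of_pos_right _ hcV)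
    (show 0 ≤ 2 * ε by linarith)
  have hMV := entropyModulus_mono hcV (Nat.le_mul_of_pos_left _ hcU)
    (show 0 ≤ 2 * ε by linarith)
  have hνR : (jointLaw R κ).map (fun t => (t.1, t.2.1)) = R := jointLaw_map_fst R κ
  have hAR : simA.map (fun t => t.2) = R := bind_map_const _ _ _ _ fun _ _ => rfl
  have hBR : simB.map (fun t => (t.1, t.2.1)) = R := bind_map_const _ _ _ _ fun _ _ => rfl
  have hBid : simB = simB.map fun t => (t.1, t.2.1, t.2.2) := (PMF.map_id simB).symm
  set ν := jointLaw R κ with hν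
  refine ⟨?_, ?_, ?_⟩
  -- Security against Alice: as `σA - U - V`, `H(V|U) = H(V|U,σA) ≤ H(V|σA)`, which is close to its
  -- value at the actual view, where the leakage bound applies. The two comparisons of laws cost one
  -- modulus each.
  · have s1 : condEntropy ν (fun t => t.2.1) (fun t => t.1)
        = condEntropy simA (fun t => t.2.2) (fun t => t.2.1) :=
      (condEntropy_eq_of_map_eq hνR Prod.snd Prod.fst).symm.trans
        (condEntropy_eq_of_map_eq hAR Prod.snd Prod.fst)
    have s2 := condEntropy_of_isMarkov hA.symm
    have s3 : condEntropy simA (fun t => t.2.2) (fun t => (t.2.1, t.1))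
        ≤ condEntropy simA (fun t => t.2.2) (fun t => t.1) :=
      condEntropy_le_of_comp Prod.snd fun _ _ => rfl
    have s4 := condEntropy_le_of_tvDist_le (F := Prod.snd) (Z := Prod.fst) e2 hε'
    have s5 := condEntropy_le_of_tvDist_le (F := fun t => t.2.1)
      (Z := fun t => (t.1, t.2.2)) e4' hε'
    have s6 := π.leakA_le J n oA oB
    have s7 : condEntropy J (fun w => w.2.2) (fun w => w.1)
        - condEntropy J (fun w => w.2.2) (fun w => (w.2.1, w.1)) = (natTension J).1 := by
      have c1 := condEntropy_comm J (fun w => w.2.2) (fun w => w.2.1) (fun w => w.1)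
      have c2 : condEntropy J (fun w => w.2.1) (fun w => (w.2.2, w.1))
          = condEntropy J (fun w => w.2.1) (fun w => (w.1, w.2.2)) :=
        condEntropy_eq_of_determined fun ω _ ω' _ => by simp only [Prod.mk.injEq]; tauto
      simp only [natTension]
      linarith
    simp only [natTension, Prod.fst_add, Prod.smul_fst, smul_eq_mul, mul_one, id] at s5 s7 ⊢
    linarith
  · have s1 : condEntropy ν (fun t => t.1) (fun t => t.2.1)
        = condEntropy simB (fun t => t.1) (fun t => t.2.1) :=
      (condEntropy_eq_of_map_eq hνR Prod.fst Prod.snd).symm.trans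
        (condEntropy_eq_of_map_eq hBR Prod.fst Prod.snd)
    have s2 : condEntropy simB (fun t => t.1) (fun t => (t.2.1, t.2.2))
        = condEntropy simB (fun t => t.1) (fun t => t.2.1) :=
      condEntropy_of_isMarkov (hBid ▸ hB)
    have s3 : condEntropy simB (fun t => t.1) (fun t => (t.2.1, t.2.2))
        ≤ condEntropy simB (fun t => t.1) (fun t => t.2.2) :=
      condEntropy_le_of_comp Prod.snd fun _ _ => rfl
    have s4 := condEntropy_le_of_tvDist_le (F := Prod.fst) (Z := Prod.snd) e3 hε'
    have s5 := condEntropy_le_of_tvDist_le (F := fun t => t.1) (Z := fun t => t.2) e4' hε'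
    have s6 := π.leakB_le J n oA oB
    have s7 : condEntropy J (fun w => w.2.2) (fun w => w.2.1)
        - condEntropy J (fun w => w.2.2) (fun w => (w.1, w.2.1)) = (natTension J).2.1 := by
      have c1 := condEntropy_comm J (fun w => w.2.2) (fun w => w.1) (fun w => w.2.1)
      have c2 : condEntropy J (fun w => w.1) (fun w => (w.2.2, w.2.1))
          = condEntropy J (fun w => w.1) (fun w => w.2) :=
        condEntropy_eq_of_determined fun ω _ ω' _ => by simp only [Prod.ext_iff]; tauto
      simp only [natTension]
      linarith
    simp only [natTension, Prod.fst_add, Prod.snd_add, Prod.smul_fst, Prod.smul_snd, smul_eq_mul,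
      mul_one, id] at s5 s7 ⊢
    linarith
  -- Here only the closeness of the outputs is used, not the simulated views.
  · have s4 := condEntropy_le_of_tvDist_le (F := fun t => t.2.1) (Z := fun t => t.2.2) e4 hε'
    have s5 := condEntropy_le_of_tvDist_le (F := fun t => t.2.1)
      (Z := fun t => (t.1, t.2.2)) e4' hε'
    have s6 := π.outputInfo_le J n oA oB
    have s7 : condEntropy J (fun w => w.1) (fun w => w.2.2)
        - condEntropy J (fun w => w.1) (fun w => w.2) = (natTension J).2.2 := by
      have c1 := condEntropy_comm J (fun w => w.1) (fun w => w.2.1) (fun w => w.2.2)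
      simp only [natTension]
      linarith
    simp only [natTension, Prod.snd_add, Prod.smul_snd, smul_eq_mul,
      mul_one, id] at s4 s5 s7 ⊢
    linarith

end Protocol

/-! ### Independent copies -/

/-- The law of `n` independent copies of a random variable with law `p`. -/
def power {α : Type*} [Fintype α] (p : PMF α) (n : ℕ) : PMF (Fin n → α) :=
  PMF.ofFintype (fun w => ∏ i, p (w i)) (by
    classical
    have h : ∑ a, p a = 1 := (tsum_fintype fun a => p a).symm.trans p.tsum_coe
    rw [← Fintype.piFinset_univ, ← Finset.prod_univ_sum]
    simp [h])

section power

variable {α β : Type*} [Fintype α] [Fintype β]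

theorem power_apply (p : PMF α) (n : ℕ) (w : Fin n → α) : power p n w = ∏ i, p (w i) := rfl

theorem power_map (p : PMF α) (n : ℕ) (f : α → β) :
    (power p n).map (fun w i => f (w i)) = power (p.map f) n := by
  classical
  ext v
  rw [power_apply, PMF.map_apply, tsum_fintype]
  simp only [PMF.map_apply, tsum_fintype]
  rw [Finset.prod_univ_sum, Fintype.piFinset_univ]
  refine Finset.sum_congr rfl fun w _ => ?_
  rw [power_apply]
  split_ifs with h
  · exact Finset.prod_congr rfl fun i _ => by rw [if_pos (congrFun h i)]
  · obtain ⟨i, hi⟩ := Function.ne_iff.1 h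
    exact (Finset.prod_eq_zero (Finset.mem_univ i) (if_neg hi)).symm

theorem power_succ_map_apply (p : PMF α) (n : ℕ) (a : α) (w : Fin n → α) :
    (power p (n + 1)).map (fun w => (w (Fin.last n), Fin.init w)) (a, w)
      = p a * power p n w := by
  have h := map_apply_of_injective (power p (n + 1))
    (Fin.snocEquiv fun _ => α).symm.injective (Fin.snocEquiv (fun _ => α) (a, w))
  rw [Equiv.symm_apply_apply] at h
  refine h.trans ?_
  rw [power_apply, Fin.prod_univ_castSucc, mul_comm, power_apply]
  simp [Fin.snocEquiv]

theorem power_succ_map_init (p : PMF α) (n : ℕ) :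
    (power p (n + 1)).map Fin.init = power p n := by
  ext w
  have : (power p (n + 1)).map Fin.init
      = ((power p (n + 1)).map fun w => (w (Fin.last n), Fin.init w)).map Prod.snd := by
    rw [PMF.map_comp]; rfl
  rw [this, map_snd_apply]
  simp only [power_succ_map_apply, ENNReal.tsum_mul_right, PMF.tsum_coe, one_mul]

theorem power_succ_map_last (p : PMF α) (n : ℕ) :
    (power p (n + 1)).map (fun w => w (Fin.last n)) = p := by
  ext w
  have : (power p (n + 1)).map (fun w => w (Fin.last n))
      = ((power p (n + 1)).map fun w => (w (Fin.last n), Fin.init w)).map Prod.fst := by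
    rw [PMF.map_comp]; rfl
  rw [this, map_fst_apply]
  simp only [power_succ_map_apply, ENNReal.tsum_mul_left, PMF.tsum_coe, mul_one]

theorem entropy_map_equiv (p : PMF α) (e : α ≃ β) : entropy (p.map e) = entropy p := by
  unfold entropy
  rw [← e.sum_comp]
  simp only [map_apply_of_injective p e.injective]

theorem sum_toReal (p : PMF α) : ∑ a, (p a).toReal = 1 :=
  (hasSum_fintype fun a => (p a).toReal).unique (hasSum_toReal p)

theorem entropy_power (p : PMF α) (n : ℕ) : entropy (power p n) = n * entropy p := by
  induction n with
  | zero => simp [entropy, power_apply]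
  | succ n ih =>
    have h : entropy (power p (n + 1))
        = entropy ((power p (n + 1)).map (Fin.snocEquiv fun _ => α).symm) :=
      (entropy_map_equiv _ _).symm
    have h2 : ∀ a w, (power p (n + 1)).map (Fin.snocEquiv fun _ => α).symm (a, w)
      = p a * power p n w := power_succ_map_apply p n
    rw [h, entropy, Fintype.sum_prod_type]
    simp only [h2, ENNReal.toReal_mul, Real.negMulLog_mul, add_div, mul_div_assoc,
      Finset.sum_add_distrib, ← Finset.mul_sum, ← Finset.sum_mul, sum_toReal, one_mul]
    rw [← entropy, ← entropy, ih]
    push_cast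
    ring

theorem condEntropy_power {Ω : Type*} [Fintype Ω] (p : PMF Ω) (n : ℕ) (F : Ω → α) (Z : Ω → β) :
    condEntropy (power p n) (fun w i => F (w i)) (fun w i => Z (w i))
      = n * condEntropy p F Z := by
  rw [condEntropy_eq_entropy_sub, condEntropy_eq_entropy_sub, power_map, entropy_power]
  have : ((power p n).map fun w => ((fun i => F (w i)), fun i => Z (w i)))
      = (power (p.map fun ω => (F ω, Z ω)) n).map (Equiv.arrowProdEquivProdArrow (Fin n)
        (fun _ => α) fun _ => β) := by
    rw [← power_map, PMF.map_comp]; rfl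
  rw [this, entropy_map_equiv, entropy_power]
  ring

theorem iid_eq_map {X Y : Type*} [Fintype X] [Fintype Y] (P : PMF (X × Y)) (n : ℕ) :
    iid P n = (power P n).map (Equiv.arrowProdEquivProdArrow (Fin n) (fun _ => X) fun _ => Y) := by
  ext w
  have := map_apply_of_injective (power P n)
    (Equiv.arrowProdEquivProdArrow (Fin n) (fun _ => X) fun _ => Y).injective
    ((Equiv.arrowProdEquivProdArrow (Fin n) (fun _ => X) fun _ => Y).symm w)
  rw [Equiv.apply_symm_apply] at this
  rw [this]; rfl

end power

/-- Side information about one pair gives side information about independent copies with `n` times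
the tension. -/
theorem exists_tension_iid_eq {X Y Q : Type*} [Fintype X] [Fintype Y] [Fintype Q] (P : PMF (X × Y))
    (K : X × Y → PMF Q) (n : ℕ) : ∃ K' : (Fin n → X) × (Fin n → Y) → PMF (Fin n → Q),
      tension (iid P n) K' = (n : ℝ) • tension P K := by
  set J := jointLaw P K with hJ
  -- The side information for the copies consists of independent copies of `Q`.
  set f : (Fin n → X × Y × Q) → (Fin n → X) × (Fin n → Y) × (Fin n → Q) := fun w =>
    (fun i => (w i).1, fun i => (w i).2.1, fun i => (w i).2.2) with hf
  obtain ⟨K', hK'⟩ := exists_jointLaw_eq ((power J n).map f)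
  have hm : ((power J n).map f).map (fun t => (t.1, t.2.1)) = iid P n := by
    rw [iid_eq_map, ← jointLaw_map_fst P K, ← power_map, PMF.map_comp, PMF.map_comp]
    rfl
  rw [hm] at hK'
  refine ⟨K', ?_⟩
  have h2 : Real.log 2 ≠ 0 := (Real.log_pos one_lt_two).ne'
  have : Real.log 2 • tension (iid P n) K' = Real.log 2 • (n : ℝ) • tension P K := by
    rw [← natTension_jointLaw, ← hK', smul_comm, ← natTension_jointLaw]
    unfold natTension
    simp only [condEntropy_map, Prod.smul_mk, smul_eq_mul, mul_sub, ← condEntropy_power]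
    refine congrArg₂ Prod.mk ?_ (congrArg₂ Prod.mk ?_ ?_) <;> congr 1 <;>
      exact condEntropy_eq_of_determined fun ω _ ω' _ => by
        simp only [hf, funext_iff, Prod.ext_iff, forall_and]
  exact smul_right_injective _ h2 this

/-! ### Convex hulls of compact sets -/

section convex

variable {E : Type*} [NormedAddCommGroup E] [NormedSpace ℝ E]

/-- In finite dimension the convex hull of a compact set is compact. -/
theorem isCompact_convexHull [FiniteDimensional ℝ E] {s : Set E} (hs : IsCompact s) :
    IsCompact (convexHull ℝ s) := by
  classical
  rcases s.eq_empty_or_nonempty with rfl | ⟨x₀, hx₀⟩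
  · simp
  set d := Module.finrank ℝ E + 1 with hd
  have h : convexHull ℝ s = (fun t : (Fin d → ℝ) × (Fin d → E) => ∑ i, t.1 i • t.2 i) ''
      (stdSimplex ℝ (Fin d) ×ˢ Set.univ.pi fun _ => s) := by
    refine Set.Subset.antisymm (fun x hx => ?_) ?_
    · obtain ⟨ι, _, z, w, hz, hi, hw, hw1, rfl⟩ := eq_pos_convex_span_of_mem_convexHull hx
      have hc : Fintype.card ι ≤ Fintype.card (Fin d) := by
        rw [Fintype.card_fin]
        exact (hi.card_le_finrank_succ).trans
          (Nat.add_le_add_right (Submodule.finrank_le _) 1)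
      obtain ⟨e⟩ := Function.Embedding.nonempty_of_card_le hc
      -- Carathéodory gives at most `d` points; they are padded to exactly `d` by copies of `x₀`
      -- with weight zero.
      set w' : Fin d → ℝ := Function.extend e w 0 with hw'
      set z' : Fin d → E := Function.extend e z fun _ => x₀ with hz'
      have hwe : ∀ j, w' (e j) = w j := fun j => e.injective.extend_apply _ _ _
      have hze : ∀ j, z' (e j) = z j := fun j => e.injective.extend_apply _ _ _
      have hwn : ∀ i, (¬∃ j, e j = i) → w' i = 0 := fun i hi => Function.extend_apply' _ _ _ hi
      have hzn : ∀ i, (¬∃ j, e j = i) → z' i = x₀ := fun i hi => Function.extend_apply' _ _ _ hi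
      refine ⟨(w', z'), ⟨⟨fun i => ?_, ?_⟩, fun i _ => ?_⟩, ?_⟩
      · by_cases hi : ∃ j, e j = i
        · obtain ⟨j, rfl⟩ := hi
          exact (hw j).le.trans_eq (hwe j).symm
        · exact (hwn i hi).ge
      · rw [← hw1]
        refine (Fintype.sum_of_injective e e.injective w w' ?_ fun j => (hwe j).symm).symm
        exact fun i hi => hwn i hi
      · by_cases hi : ∃ j, e j = i
        · obtain ⟨j, rfl⟩ := hi
          change z' (e j) ∈ s
          rw [hze]; exact hz ⟨j, rfl⟩
        · change z' i ∈ s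
          rw [hzn i hi]; exact hx₀
      · refine (Fintype.sum_of_injective e e.injective (fun j => w j • z j)
          (fun i => w' i • z' i) (fun i hi => ?_) fun j => ?_).symm
        · rw [hwn i hi, zero_smul]
        · rw [hwe, hze]
    · rintro _ ⟨⟨w, z⟩, ⟨hw, hz⟩, rfl⟩
      exact (convex_convexHull ℝ s).sum_mem (fun i _ => hw.1 i) hw.2
        fun i _ => subset_convexHull ℝ s (hz i (Set.mem_univ i))
  rw [h]
  exact ((isCompact_stdSimplex ℝ (Fin d)).prod (isCompact_univ_pi fun _ => hs)).image
    (by fun_prop)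

/-- A closed convex set contains countable convex combinations of its points. -/
theorem hasSum_mem_of_convex {ι : Type*} {C : Set E} (hC : Convex ℝ C) (hc : IsClosed C)
    {w : ι → ℝ} {z : ι → E} {x : E} (hw : ∀ i, 0 ≤ w i) (hw1 : HasSum w 1)
    (hz : ∀ i, w i ≠ 0 → z i ∈ C) (hx : HasSum (fun i => w i • z i) x) : x ∈ C := by
  classical
  obtain ⟨i₀, hi₀⟩ : ∃ i, w i ≠ 0 := by
    by_contra! h
    have hw0 : HasSum w 0 := by
      rw [funext h]; exact hasSum_zero
    exact one_ne_zero (hw1.unique hw0)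
  -- The weight missing from a finite partial sum is placed on `z i₀`, which makes it a convex
  -- combination with the same limit.
  have hlim : Tendsto (fun s : Finset ι => (1 - ∑ i ∈ s, w i) • z i₀ + ∑ i ∈ s, w i • z i)
      atTop (𝓝 x) := by
    have h1 : Tendsto (fun s : Finset ι => ∑ i ∈ s, w i) atTop (𝓝 1) := hw1
    have h2 : Tendsto (fun s : Finset ι => ∑ i ∈ s, w i • z i) atTop (𝓝 x) := hx
    have := ((tendsto_const_nhds (x := (1 : ℝ))).sub h1).smul_const (z i₀) |>.add h2
    simpa using this
  refine hc.mem_of_tendsto hlim (Eventually.of_forall fun s => ?_)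
  -- Points of weight zero need not lie in `C`, so they are replaced by `z i₀`.
  set z' : ι → E := fun i => if w i = 0 then z i₀ else z i with hz'
  have h1 : ∑ i ∈ s, w i • z i = ∑ i ∈ s, w i • z' i := by
    refine Finset.sum_congr rfl fun i _ => ?_
    by_cases h : w i = 0 <;> simp [hz', h]
  have hle : ∑ i ∈ s, w i ≤ 1 := sum_le_hasSum s (fun i _ => hw i) hw1
  have := hC.sum_mem (t := Finset.insertNone s)
    (w := fun o => o.elim (1 - ∑ i ∈ s, w i) w) (z := fun o => o.elim (z i₀) z')
    (by rintro (_ | i) _; exacts [sub_nonneg.2 hle, hw i])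
    (by rw [Finset.sum_insertNone]; simp)
    (by
      rintro (_ | i) _
      · exact hz i₀ hi₀
      · by_cases h : w i = 0
        · simpa [hz', h] using hz i₀ hi₀
        · simpa [hz', h] using hz i h)
  rw [Finset.sum_insertNone] at this
  rw [h1]
  exact this

end convex

/-! ### The set of tensions -/

section tensions

variable {U V : Type*} [Fintype U] [Fintype V]

/-- The tension of a pair with law `R` as a function of the (unnormalised) conditional law given the
side information. -/
def tensionDensity (R : PMF (U × V)) (p : U × V → ℝ) : ℝ × ℝ × ℝ :=
  (condEntropy R Prod.snd Prod.fst * ∑ w, p w - ∑ u, massEntropy fun v => p (u, v),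
   condEntropy R Prod.fst Prod.snd * ∑ w, p w - ∑ v, massEntropy fun u => p (u, v),
   (massEntropy fun v => ∑ u, p (u, v)) - ∑ u, massEntropy fun v => p (u, v))

theorem continuous_tensionDensity (R : PMF (U × V)) : Continuous (tensionDensity R) := by
  have h1 : ∀ u, Continuous fun p : U × V → ℝ => massEntropy fun v => p (u, v) := fun u =>
    continuous_massEntropy.comp (by fun_prop)
  have h2 : ∀ v, Continuous fun p : U × V → ℝ => massEntropy fun u => p (u, v) := fun v =>
    continuous_massEntropy.comp (by fun_prop)
  have h3 : Continuous fun p : U × V → ℝ => massEntropy fun v => ∑ u, p (u, v) :=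
    continuous_massEntropy.comp (by fun_prop)
  unfold tensionDensity
  fun_prop

theorem tensionDensity_mul (R : PMF (U × V)) (c : ℝ) (p : U × V → ℝ) :
    tensionDensity R (fun w => c * p w) = c • tensionDensity R p := by
  unfold tensionDensity
  simp only [massEntropy_mul_left, ← Finset.mul_sum, Prod.smul_mk, smul_eq_mul]
  refine congrArg₂ Prod.mk ?_ (congrArg₂ Prod.mk ?_ ?_) <;> ring

/-- The entropies `H(V|U)` and `H(U|V)` depend on `R` only and are spread over `t` in proportion to
mass; the other terms are sums over `t` by definition. So each value of the side information
contributes a function of its unnormalised law alone. -/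
theorem hasSum_natTension {T : Type*} {R : PMF (U × V)} {ν : PMF (U × V × T)}
    (h : ν.map (fun t => (t.1, t.2.1)) = R) :
    HasSum (fun t => tensionDensity R fun w => (ν (w.1, w.2, t)).toReal) (natTension ν) := by
  have hT : HasSum (fun t => ∑ w : U × V, (ν (w.1, w.2, t)).toReal) 1 := by
    have hs := ((Equiv.prodAssoc U V T).hasSum_iff.2 (hasSum_toReal ν))
    exact ((Equiv.prodComm T (U × V)).hasSum_iff.2 hs).prod_fiberwise fun t => hasSum_fintype _
  have hV : HasSum (fun t => ∑ u, massEntropy fun v => (ν (u, v, t)).toReal)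
      (condEntropy ν (fun t => t.2.1) fun t => (t.1, t.2.2)) := by
    have hs := (summable_condEntropy ν (fun t => t.2.1) fun t => (t.1, t.2.2)).hasSum
    have := ((Equiv.prodComm T U).hasSum_iff.2 hs).prod_fiberwise fun t => hasSum_fintype _
    refine this.congr_fun fun t => Finset.sum_congr rfl fun u _ => ?_
    refine congrArg massEntropy (funext fun v => congrArg ENNReal.toReal ?_)
    exact Eq.symm <| map_apply_of_injective ν (f := fun t => (t.2.1, t.1, t.2.2))
      (fun t t' h => by simp_all [Prod.ext_iff]) (u, v, t)
  have hU : HasSum (fun t => ∑ v, massEntropy fun u => (ν (u, v, t)).toReal)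
      (condEntropy ν (fun t => t.1) fun t => t.2) := by
    have hs := (summable_condEntropy ν (fun t => t.1) fun t => t.2).hasSum
    have := ((Equiv.prodComm T V).hasSum_iff.2 hs).prod_fiberwise fun t => hasSum_fintype _
    refine this.congr_fun fun t => Finset.sum_congr rfl fun v _ => ?_
    refine congrArg massEntropy (funext fun u => congrArg ENNReal.toReal ?_)
    exact Eq.symm <| map_apply_of_injective ν (f := fun t => (t.1, t.2))
      (fun t t' h => by simp_all [Prod.ext_iff]) (u, v, t)
  have hM : HasSum (fun t => massEntropy fun v => ∑ u, (ν (u, v, t)).toReal)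
      (condEntropy ν (fun t => t.2.1) fun t => t.2.2) := by
    have hs := (summable_condEntropy ν (fun t => t.2.1) fun t => t.2.2).hasSum
    refine hs.congr_fun fun t => ?_
    refine congrArg massEntropy (funext fun v => ?_)
    rw [← ENNReal.toReal_sum fun u _ => ν.apply_ne_top _,
      ← tsum_fintype (L := .unconditional _) (fun u => ν (u, v, t)), ← map_snd_apply]
  have e1 : condEntropy ν (fun t => t.2.1) (fun t => t.1) = condEntropy R Prod.snd Prod.fst :=
    (condEntropy_eq_of_map_eq h Prod.snd Prod.fst).symm
  have e2 : condEntropy ν (fun t => t.1) (fun t => t.2.1) = condEntropy R Prod.fst Prod.snd :=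
    (condEntropy_eq_of_map_eq h Prod.fst Prod.snd).symm
  unfold natTension tensionDensity
  rw [e1, e2]
  have h1 := (hT.mul_left (condEntropy R Prod.snd Prod.fst)).sub hV
  have h2 := (hT.mul_left (condEntropy R Prod.fst Prod.snd)).sub hU
  rw [mul_one] at h1 h2
  exact h1.prodMk (h2.prodMk (hM.sub hV))

/-- The graph of the tension density over the simplex of laws. -/
def tensionGraph (R : PMF (U × V)) : Set ((U × V → ℝ) × ℝ × ℝ × ℝ) :=
  (fun p => (p, tensionDensity R p)) '' stdSimplex ℝ (U × V)

/-- The tensions, in nats, of a pair with law `R`. -/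
def natTensions (R : PMF (U × V)) : Set (ℝ × ℝ × ℝ) :=
  {t | ((fun w => (R w).toReal), t) ∈ convexHull ℝ (tensionGraph R)}

theorem isCompact_convexHull_tensionGraph (R : PMF (U × V)) :
    IsCompact (convexHull ℝ (tensionGraph R)) :=
  isCompact_convexHull ((isCompact_stdSimplex ℝ (U × V)).image
    (continuous_id.prodMk (continuous_tensionDensity R)))

/-- A slice of a convex set; in terms of side information this is time sharing. -/
theorem convex_natTensions (R : PMF (U × V)) : Convex ℝ (natTensions R) := by
  intro s hs t ht a b ha hb hab
  have := convex_convexHull ℝ (tensionGraph R) hs ht ha hb hab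
  have e : a • (fun w => (R w).toReal) + b • (fun w => (R w).toReal)
      = fun w => (R w).toReal := by rw [← add_smul, hab, one_smul]
  change (a • (fun w => (R w).toReal) + b • (fun w => (R w).toReal), a • s + b • t) ∈ _ at this
  rwa [e] at this

/-- A closed slice of a compact set. Limits of tensions are thus attained, without tracking the
alphabet of the side information. -/
theorem isCompact_natTensions (R : PMF (U × V)) : IsCompact (natTensions R) := by
  have h := (isCompact_convexHull_tensionGraph R)
  have hc : IsClosed (natTensions R) := h.isClosed.preimage (by fun_prop)
  refine (h.image continuous_snd).of_isClosed_subset hc fun t ht => ⟨_, ht, rfl⟩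

/-- By homogeneity, the law of the pair together with the tension is a convex combination, possibly
infinite, of points of the graph, with weights the masses of the values of the side information. A
closed convex set contains it, so unbounded transcripts do no harm. -/
theorem natTension_mem {T : Type*} {R : PMF (U × V)} {ν : PMF (U × V × T)}
    (h : ν.map (fun t => (t.1, t.2.1)) = R) : natTension ν ∈ natTensions R := by
  set m : T → U × V → ℝ := fun t w => (ν (w.1, w.2, t)).toReal with hm
  set S : T → ℝ := fun t => ∑ w, m t w with hS
  have hm0 : ∀ t w, 0 ≤ m t w := fun t w => ENNReal.toReal_nonneg
  have hS0 : ∀ t, 0 ≤ S t := fun t => Finset.sum_nonneg fun w _ => hm0 t w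
  have hS1 : HasSum S 1 := by
    have hs := ((Equiv.prodAssoc U V T).hasSum_iff.2 (hasSum_toReal ν))
    exact ((Equiv.prodComm T (U × V)).hasSum_iff.2 hs).prod_fiberwise fun t => hasSum_fintype _
  -- If `S t = 0` then `m t` vanishes, so the junk value of the inverse is harmless.
  have hmS : ∀ t, m t = fun w => S t * ((S t)⁻¹ * m t w) := by
    intro t
    ext w
    by_cases h0 : S t = 0
    · rw [h0, zero_mul]
      exact (Finset.sum_eq_zero_iff_of_nonneg fun w _ => hm0 t w).1 h0 w (Finset.mem_univ w)
    · rw [mul_inv_cancel_left₀ h0]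
  have hR : HasSum m fun w => (R w).toReal := by
    refine Pi.hasSum.2 fun w => ?_
    refine hasSum_toReal_of_tsum_eq (PMF.apply_ne_top _ _) ?_
    have : R = (ν.map (Equiv.prodAssoc U V T).symm).map Prod.fst := by
      rw [← h, PMF.map_comp]; rfl
    rw [this, map_fst_apply]
    exact tsum_congr fun t =>
      map_apply_of_injective ν (Equiv.prodAssoc U V T).symm.injective (w.1, w.2, t)
  refine hasSum_mem_of_convex (convex_convexHull ℝ (tensionGraph R))
    (isCompact_convexHull_tensionGraph R).isClosed (w := S)
    (z := fun t => (fun w => (S t)⁻¹ * m t w, tensionDensity R fun w => (S t)⁻¹ * m t w))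
    hS0 hS1 (fun t ht => subset_convexHull ℝ _ ⟨_, ⟨fun w => ?_, ?_⟩, rfl⟩) ?_
  · exact mul_nonneg (inv_nonneg.2 (hS0 t)) (hm0 t w)
  · rw [← Finset.mul_sum]
    exact inv_mul_cancel₀ ht
  · refine (hR.prodMk (hasSum_natTension h)).congr_fun fun t => ?_
    exact Prod.ext (hmS t).symm
      ((tensionDensity_mul R _ _).symm.trans (congrArg (tensionDensity R) (hmS t).symm))

/-- A point of the convex hull is a finite convex combination; its index set serves as alphabet of
`Q`, with `w i * p i` as joint law. -/
theorem exists_tension_eq_of_mem {R : PMF (U × V)} {t : ℝ × ℝ × ℝ} (ht : t ∈ natTensions R) :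
    ∃ (k : ℕ) (K : U × V → PMF (Fin k)), natTension (jointLaw R K) = t := by
  obtain ⟨ι, _, z, w, hz, -, hw, hw1, hsum⟩ := eq_pos_convex_span_of_mem_convexHull ht
  choose p hp hpz using fun i => hz ⟨i, rfl⟩
  set e := Fintype.equivFin ι
  have hR : ∀ x, ∑ i, w i * p i x = (R x).toReal := fun x => by
    have := congrFun (congrArg Prod.fst hsum) x
    simpa [Prod.fst_sum, ← hpz] using this
  have hΦ : ∑ i, w i • tensionDensity R (p i) = t := by
    have := congrArg Prod.snd hsum
    simpa [Prod.snd_sum, ← hpz] using this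
  have h0 : ∀ i x, 0 ≤ w i * p i x := fun i x => mul_nonneg (hw i).le ((hp i).1 x)
  have hsR : ∀ x, ∑ i, ENNReal.ofReal (w i * p i x) = R x := fun x => by
    rw [← ENNReal.ofReal_sum_of_nonneg fun i _ => h0 i x, hR,
      ENNReal.ofReal_toReal (R.apply_ne_top x)]
  have hsk : ∀ x, ∑ j, ENNReal.ofReal (w (e.symm j) * p (e.symm j) x) = R x := fun x => by
    rw [← hsR x]
    exact e.symm.sum_comp fun i => ENNReal.ofReal (w i * p i x)
  set ν : PMF (U × V × Fin (Fintype.card ι)) := PMF.ofFintype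
    (fun s => ENNReal.ofReal (w (e.symm s.2.2) * p (e.symm s.2.2) (s.1, s.2.1))) (by
      simp only [Fintype.sum_prod_type, hsk]
      rw [← Fintype.sum_prod_type (f := fun x => R x)]
      exact (tsum_fintype fun x => R x).symm.trans R.tsum_coe) with hν
  have hνR : ν.map (fun s => (s.1, s.2.1)) = R := by
    ext x
    have : ν.map (fun s => (s.1, s.2.1)) = (ν.map (Equiv.prodAssoc U V _).symm).map Prod.fst := by
      rw [PMF.map_comp]; rfl
    rw [this, map_fst_apply, tsum_fintype, ← hsk x]
    exact Finset.sum_congr rfl fun j _ =>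
      map_apply_of_injective ν (Equiv.prodAssoc U V _).symm.injective (x.1, x.2, j)
  obtain ⟨K, hK⟩ := exists_jointLaw_eq ν
  rw [hνR] at hK
  refine ⟨_, K, ?_⟩
  rw [← hK]
  refine (hasSum_natTension hνR).unique ?_
  rw [← hΦ, ← e.symm.sum_comp]
  refine (hasSum_fintype _).congr_fun fun j => ?_
  rw [← tensionDensity_mul]
  congr 1; ext x
  exact ENNReal.toReal_ofReal (h0 _ _)

end tensions

/-! ### Single-letterization -/

section singleLetter

variable {U V T : Type*} [Fintype U] [Fintype V]

theorem natTension_nonneg (ν : PMF (U × V × T)) : 0 ≤ natTension ν := by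
  refine ⟨?_, ?_, ?_⟩
  · exact sub_nonneg.2 (condEntropy_le_of_comp Prod.fst fun _ _ => rfl)
  · exact sub_nonneg.2 (condEntropy_le_of_comp Prod.fst fun _ _ => rfl)
  · exact sub_nonneg.2 (condEntropy_le_of_comp Prod.snd fun _ _ => rfl)

theorem natTensions_nonempty (R : PMF (U × V)) : (natTensions R).Nonempty :=
  ⟨_, natTension_mem (jointLaw_map_fst R fun _ => PMF.pure ())⟩

theorem condEntropy_iid_snd {R : PMF (U × V)} {n : ℕ} {ν : PMF ((Fin n → U) × (Fin n → V) × T)}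
    (h : ν.map (fun t => (t.1, t.2.1)) = iid R n) :
    condEntropy ν (fun t => t.2.1) (fun t => t.1) = n * condEntropy R Prod.snd Prod.fst := by
  rw [← condEntropy_power]
  exact (condEntropy_eq_of_map_eq h Prod.snd Prod.fst).symm.trans
    (condEntropy_eq_of_map_eq (iid_eq_map R n).symm Prod.snd Prod.fst)

theorem condEntropy_iid_fst {R : PMF (U × V)} {n : ℕ} {ν : PMF ((Fin n → U) × (Fin n → V) × T)}
    (h : ν.map (fun t => (t.1, t.2.1)) = iid R n) :
    condEntropy ν (fun t => t.1) (fun t => t.2.1) = n * condEntropy R Prod.fst Prod.snd := by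
  rw [← condEntropy_power]
  exact (condEntropy_eq_of_map_eq h Prod.fst Prod.snd).symm.trans
    (condEntropy_eq_of_map_eq (iid_eq_map R n).symm Prod.fst Prod.snd)

variable {n : ℕ}

/-- Drop the last pair. -/
def dropLast (t : (Fin (n + 1) → U) × (Fin (n + 1) → V) × T) : (Fin n → U) × (Fin n → V) × T :=
  (Fin.init t.1, Fin.init t.2.1, t.2.2)

/-- The last pair, the other ones becoming side information. -/
def lastPair (t : (Fin (n + 1) → U) × (Fin (n + 1) → V) × T) :
    U × V × T × (Fin n → U) × (Fin n → V) :=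
  (t.1 (Fin.last n), t.2.1 (Fin.last n), t.2.2, Fin.init t.1, Fin.init t.2.1)

theorem map_dropLast {R : PMF (U × V)} {ν : PMF ((Fin (n + 1) → U) × (Fin (n + 1) → V) × T)}
    (h : ν.map (fun t => (t.1, t.2.1)) = iid R (n + 1)) :
    (ν.map dropLast).map (fun t => (t.1, t.2.1)) = iid R n := by
  have h1 := congrArg (PMF.map fun w : (Fin (n + 1) → U) × (Fin (n + 1) → V) =>
    (Fin.init w.1, Fin.init w.2)) h
  rw [PMF.map_comp, iid_eq_map, PMF.map_comp] at h1
  rw [iid_eq_map, ← power_succ_map_init, PMF.map_comp, PMF.map_comp]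
  exact h1

theorem map_lastPair {R : PMF (U × V)} {ν : PMF ((Fin (n + 1) → U) × (Fin (n + 1) → V) × T)}
    (h : ν.map (fun t => (t.1, t.2.1)) = iid R (n + 1)) :
    (ν.map lastPair).map (fun t => (t.1, t.2.1)) = R := by
  have h1 := congrArg (PMF.map fun w : (Fin (n + 1) → U) × (Fin (n + 1) → V) =>
    (w.1 (Fin.last n), w.2 (Fin.last n))) h
  rw [PMF.map_comp, iid_eq_map, PMF.map_comp] at h1
  conv_rhs => rw [← power_succ_map_last R n]
  rw [PMF.map_comp]
  exact h1

theorem condEntropy_snoc {Ω α ζ : Type*} [Fintype α] (μ : PMF Ω) (F : Ω → Fin (n + 1) → α)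
    (Z : Ω → ζ) : condEntropy μ F Z = condEntropy μ (fun ω => Fin.init (F ω)) Z
      + condEntropy μ (fun ω => F ω (Fin.last n)) fun ω => ((Fin.init (F ω) : Fin n → α), Z ω) := by
  rw [← condEntropy_prod, ← condEntropy_comp_equiv μ (Fin.snocEquiv fun _ => α).symm F Z]
  rfl

/-- The tension is superadditive over independent copies. -/
theorem natTension_dropLast_add_lastPair_le {R : PMF (U × V)}
    {ν : PMF ((Fin (n + 1) → U) × (Fin (n + 1) → V) × T)}
    (h : ν.map (fun t => (t.1, t.2.1)) = iid R (n + 1)) :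
    natTension (ν.map dropLast) + natTension (ν.map lastPair) ≤ natTension ν := by
  have hd := map_dropLast h
  have hl := map_lastPair h
  have v1 := condEntropy_iid_snd h
  have v2 := condEntropy_iid_snd hd
  have v3 := (condEntropy_eq_of_map_eq hl Prod.snd Prod.fst).symm
  have u1 := condEntropy_iid_fst h
  have u2 := condEntropy_iid_fst hd
  have u3 := (condEntropy_eq_of_map_eq hl Prod.fst Prod.snd).symm
  push_cast at v1 u1
  unfold natTension
  -- The independence of the copies is used here: `H(Vⁿ|Uⁿ)` and `H(Uⁿ|Vⁿ)` are additive. The rest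
  -- is the chain rule and dropping conditions.
  rw [v1, v2, u1, u2]
  refine ⟨?_, ?_, ?_⟩
  · have c1 := condEntropy_snoc ν (fun t => t.2.1) (fun t => (t.1, t.2.2))
    have c2 : condEntropy ν (fun t => (Fin.init t.2.1 : Fin n → V)) (fun t => (t.1, t.2.2))
        ≤ condEntropy ν (fun t => (Fin.init t.2.1 : Fin n → V))
          fun t => ((Fin.init t.1 : Fin n → U), t.2.2) :=
      condEntropy_le_of_comp (fun z => (Fin.init z.1, z.2)) fun _ _ => rfl
    have c3 : condEntropy ν (fun t => t.2.1 (Fin.last n))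
          (fun t => ((Fin.init t.2.1 : Fin n → V), t.1, t.2.2))
        ≤ condEntropy ν (fun t => t.2.1 (Fin.last n)) fun t =>
          (t.1 (Fin.last n), t.2.2, (Fin.init t.1 : Fin n → U), (Fin.init t.2.1 : Fin n → V)) :=
      condEntropy_le_of_comp (fun z => (z.2.1 (Fin.last n), z.2.2, Fin.init z.2.1, z.1))
        fun _ _ => rfl
    simp only [condEntropy_map, Prod.mk_add_mk] at v3 ⊢
    rw [v3]
    simp only [dropLast, lastPair]
    linarith
  · have c1 := condEntropy_snoc ν (fun t => t.1) (fun t => t.2)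
    have c2 : condEntropy ν (fun t => (Fin.init t.1 : Fin n → U)) (fun t => t.2)
        ≤ condEntropy ν (fun t => (Fin.init t.1 : Fin n → U))
          fun t => ((Fin.init t.2.1 : Fin n → V), t.2.2) :=
      condEntropy_le_of_comp (fun z => (Fin.init z.1, z.2)) fun _ _ => rfl
    have c3 : condEntropy ν (fun t => t.1 (Fin.last n))
          (fun t => ((Fin.init t.1 : Fin n → U), t.2))
        ≤ condEntropy ν (fun t => t.1 (Fin.last n)) fun t =>
          (t.2.1 (Fin.last n), t.2.2, (Fin.init t.1 : Fin n → U), (Fin.init t.2.1 : Fin n → V)) :=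
      condEntropy_le_of_comp (fun z => (z.2.1 (Fin.last n), z.2.2, z.1, Fin.init z.2.1))
        fun _ _ => rfl
    simp only [condEntropy_map, Prod.mk_add_mk] at u3 ⊢
    rw [u3]
    simp only [dropLast, lastPair]
    linarith
  -- The third coordinate needs no independence. The chain rule expands both terms, and `c3` works
  -- because the earlier pairs belong to the side information of the last one.
  · have c1 := condEntropy_snoc ν (fun t => t.2.1) (fun t => t.2.2)
    have c2 := condEntropy_snoc ν (fun t => t.2.1) (fun t => (t.1, t.2.2))
    have c3 : condEntropy ν (fun t => t.2.1 (Fin.last n)) (fun t =>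
          (t.2.2, (Fin.init t.1 : Fin n → U), (Fin.init t.2.1 : Fin n → V)))
        ≤ condEntropy ν (fun t => t.2.1 (Fin.last n))
          (fun t => ((Fin.init t.2.1 : Fin n → V), t.2.2)) :=
      condEntropy_le_of_comp (fun z => (z.2.2, z.1)) fun _ _ => rfl
    have c4 : condEntropy ν (fun t => (Fin.init t.2.1 : Fin n → V)) (fun t => (t.1, t.2.2))
        ≤ condEntropy ν (fun t => (Fin.init t.2.1 : Fin n → V))
          fun t => ((Fin.init t.1 : Fin n → U), t.2.2) :=
      condEntropy_le_of_comp (fun z => (Fin.init z.1, z.2)) fun _ _ => rfl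
    have c5 : condEntropy ν (fun t => t.2.1 (Fin.last n))
          (fun t => ((Fin.init t.2.1 : Fin n → V), t.1, t.2.2))
        ≤ condEntropy ν (fun t => t.2.1 (Fin.last n)) fun t =>
          (t.1 (Fin.last n), t.2.2, (Fin.init t.1 : Fin n → U), (Fin.init t.2.1 : Fin n → V)) :=
      condEntropy_le_of_comp (fun z => (z.2.1 (Fin.last n), z.2.2, Fin.init z.2.1, z.1))
        fun _ _ => rfl
    simp only [condEntropy_map, Prod.mk_add_mk, dropLast, lastPair]
    linarith

/-- Side information about `n` independent copies gives side information about a single pair. -/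
theorem exists_natTensions_smul_le (R : PMF (U × V)) : ∀ (n : ℕ)
    (ν : PMF ((Fin n → U) × (Fin n → V) × T)), ν.map (fun t => (t.1, t.2.1)) = iid R n →
    ∃ t ∈ natTensions R, (n : ℝ) • t ≤ natTension ν
  | 0, ν, _ => by
    obtain ⟨t, ht⟩ := natTensions_nonempty R
    exact ⟨t, ht, by simpa using natTension_nonneg ν⟩
  | n + 1, ν, h => by
    obtain ⟨t, ht, hle⟩ := exists_natTensions_smul_le R n _ (map_dropLast h)
    have hs := natTension_mem (map_lastPair h)
    have hn : (0 : ℝ) < n + 1 := by positivity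
    -- The running average: weight `n / (n + 1)` on the first `n` pairs and `1 / (n + 1)` on the
    -- last.
    refine ⟨_, convex_natTensions R ht hs (a := n / (n + 1)) (b := 1 / (n + 1)) (by positivity)
      (by positivity) (by field_simp), ?_⟩
    refine le_trans (le_of_eq ?_) ((add_le_add_left hle _).trans
      (natTension_dropLast_add_lastPair_le h))
    rw [smul_add, smul_smul, smul_smul]
    push_cast
    rw [mul_div_cancel₀ _ hn.ne', mul_one_div_cancel hn.ne', one_smul]

end singleLetter

/-! ### The rate -/

section rate

variable {X Y U V : Type*} [Fintype X] [Fintype Y] [Fintype U] [Fintype V]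

theorem statRate_le_supRatio (P : PMF (X × Y)) (R : PMF (U × V)) {ε : ℝ} (hε : 0 < ε) :
    statRate P R ≤ supRatio P R ε := by
  refine le_of_tendsto (tendsto_supRatio P R) ?_
  filter_upwards [Ioo_mem_nhdsGT hε] with δ hδ
  refine sSup_le_sSup ?_
  rintro q ⟨n₁, n₂, h₁, h₂, ⟨π, hv, σA, σB, hA, hB, a, b, c⟩, rfl⟩
  have h := hδ.2.le
  exact ⟨n₁, n₂, h₁, h₂, ⟨π, hv, σA, σB, hA, hB, a.trans h, b.trans h, c.trans h⟩, rfl⟩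

/-- The logarithm of the alphabet size is linear in the number of copies, and `n ≥ 1` absorbs the
binary entropy. Divided by `n`, the error does not depend on `n`. -/
theorem entropyModulus_card_pow_le {a b n : ℕ} {ε : ℝ} (hn : 0 < n) (hε : 0 ≤ ε) (hε' : ε ≤ 1) :
    entropyModulus (a ^ n * b ^ n) ε ≤ n * entropyModulus (a * b) ε := by
  have h1 : (1 : ℝ) ≤ n := by exact_mod_cast hn
  have h2 := Real.binEntropy_nonneg hε hε'
  unfold entropyModulus
  rw [← mul_pow, Nat.cast_pow, Real.log_pow]
  nlinarith

/-- The bound on the single-letter tension that a secure protocol of ratio above `r'` gives. -/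
theorem exists_natTensions_le {P : PMF (X × Y)} {R : PMF (U × V)} {r' ε : ℝ} (hr' : 0 < r')
    (hrate : ENNReal.ofReal r' < statRate P R) (hε : 0 < ε) (hε' : ε ≤ 1 / 4)
    {s : ℝ × ℝ × ℝ} (hs : s ∈ tensionRegion P) : ∃ t ∈ natTensions R,
      t ≤ (Real.log 2 / r') • s
        + (2 * entropyModulus (Fintype.card U * Fintype.card V) (2 * ε)) • (1, 1, 1) := by
  obtain ⟨hs0, _, ⟨k, K, rfl⟩, hK⟩ := hs
  obtain ⟨_, ⟨n₁, n₂, h₁, h₂, ⟨π, hπ⟩, rfl⟩, hlt⟩ :=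
    lt_sSup_iff.1 (hrate.trans_le (statRate_le_supRatio P R hε))
  have hratio : r' * n₂ < n₁ := by
    rw [ENNReal.lt_div_iff_mul_lt (by simp) (by simp), ← ENNReal.ofReal_natCast n₂,
      ← ENNReal.ofReal_natCast n₁, ← ENNReal.ofReal_mul hr'.le] at hlt
    exact (ENNReal.ofReal_lt_ofReal_iff (by positivity)).1 hlt
  obtain ⟨K', hK'⟩ := exists_tension_iid_eq P K n₂
  obtain ⟨κ, hκ⟩ := hπ.exists_natTension_le hε (by linarith) K'
  obtain ⟨t, ht, hle⟩ := exists_natTensions_smul_le R n₁ _ (jointLaw_map_fst (iid R n₁) κ)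
  refine ⟨t, ht, ?_⟩
  have hn₁ : (0 : ℝ) < n₁ := by exact_mod_cast h₁
  have hM := entropyModulus_card_pow_le (a := Fintype.card U) (b := Fintype.card V) h₁
    (show 0 ≤ 2 * ε by linarith) (by linarith)
  have hlog : 0 < Real.log 2 := Real.log_pos one_lt_two
  rw [hK', Fintype.card_fun, Fintype.card_fun, Fintype.card_fin] at hκ
  have h := hle.trans hκ
  -- One coordinate of the bound, divided by `n₁`. The ratio `n₂ / n₁` is below `1 / r'`, and `0 ≤
  -- z` allows it to be replaced by `1 / r'`.
  have key : ∀ {x y z m : ℝ}, 0 ≤ z → y ≤ z →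
      m ≤ n₁ * entropyModulus (Fintype.card U * Fintype.card V) (2 * ε) →
      n₁ * x ≤ Real.log 2 * (n₂ * y) + 2 * m →
      x ≤ Real.log 2 / r' * z
        + 2 * entropyModulus (Fintype.card U * Fintype.card V) (2 * ε) := by
    intro x y z m hz hyz hm h
    have h3 : (n₂ : ℝ) * y ≤ n₁ / r' * z := by
      have : (n₂ : ℝ) ≤ n₁ / r' := by rw [le_div_iff₀ hr']; linarith
      exact (mul_le_mul_of_nonneg_left hyz (Nat.cast_nonneg _)).trans
        (mul_le_mul_of_nonneg_right this hz)
    have h4 := mul_le_mul_of_nonneg_left h3 hlog.le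
    refine le_of_mul_le_mul_left ?_ hn₁
    have h5 : n₁ * (Real.log 2 / r' * z) = Real.log 2 * (n₁ / r' * z) := by ring
    rw [mul_add, h5]
    linarith
  obtain ⟨x₁, x₂, x₃⟩ := t
  obtain ⟨z₁, z₂, z₃⟩ := s
  generalize tension P K = y at h hK
  obtain ⟨y₁, y₂, y₃⟩ := y
  simp only [Prod.smul_mk, smul_eq_mul, mul_one, Prod.mk_add_mk, Prod.mk_le_mk] at h hK ⊢
  exact ⟨key hs0.1 hK.1 hM h.1, key hs0.2.1 hK.2.1 hM h.2.1, key hs0.2.2 hK.2.2 hM h.2.2⟩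

end rate

end

end SecureSampling

/-! ### The theorem: passage to the limit -/

theorem mainTheorem3 {X Y U V : Type*} [Fintype X] [Fintype Y] [Fintype U] [Fintype V]
    (P : PMF (X × Y)) (R : PMF (U × V)) (r : ℝ) (hr : 0 < r)
    (hrate : ENNReal.ofReal r ≤ SecureSampling.statRate P R) :
    SecureSampling.tensionRegion P ⊆ r • SecureSampling.tensionRegion R := by
  open SecureSampling in
  intro s hs
  have hlog : 0 < Real.log 2 := Real.log_pos one_lt_two
  -- The region of tension in nats, up to the orthant condition. It is closed as the sum of a
  -- compact and a closed set.
  set C : Set (ℝ × ℝ × ℝ) := natTensions R + Set.Ici 0 with hC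
  have hCc : IsClosed C := isClosed_Ici.add_left_of_isCompact (isCompact_natTensions R)
  -- The ratio `r * (1 - ε)` is strictly below the rate, so protocols beating it exist at error `ε`;
  -- letting it tend to `r` together with `ε → 0` covers the endpoint `r = ρ`.
  have hlim : Filter.Tendsto (fun ε : ℝ => (Real.log 2 / (r * (1 - ε))) • s
      + (2 * entropyModulus (Fintype.card U * Fintype.card V) (2 * ε)) • ((1, 1, 1) : ℝ × ℝ × ℝ))
      (nhdsWithin 0 (Set.Ioi 0)) (nhds ((Real.log 2 / r) • s)) := by
    have hcont : ContinuousAt (fun ε : ℝ => (Real.log 2 / (r * (1 - ε))) • s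
        + (2 * entropyModulus (Fintype.card U * Fintype.card V) (2 * ε)) •
          ((1, 1, 1) : ℝ × ℝ × ℝ)) 0 := by
      have h0 : r * (1 - 0) ≠ 0 := by simpa using hr.ne'
      have hmod : Continuous fun ε : ℝ =>
          entropyModulus (Fintype.card U * Fintype.card V) (2 * ε) := by
        unfold entropyModulus
        have := Real.binEntropy_continuous
        fun_prop
      have hdiv : ContinuousAt (fun ε : ℝ => Real.log 2 / (r * (1 - ε))) 0 :=
        ContinuousAt.div₀ (by fun_prop) (by fun_prop) h0
      have hmod' := hmod.continuousAt (x := 0)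
      fun_prop
    have := hcont.tendsto.mono_left (nhdsWithin_le_nhds (s := Set.Ioi 0))
    simpa [entropyModulus] using this
  have hmem : (Real.log 2 / r) • s ∈ C := by
    refine hCc.mem_of_tendsto hlim ?_
    filter_upwards [Ioo_mem_nhdsGT (show (0 : ℝ) < 1 / 4 by norm_num)] with ε hε
    have h1 : r * (1 - ε) < r := by nlinarith [hε.1]
    obtain ⟨t, ht, hle⟩ := exists_natTensions_le (r' := r * (1 - ε))
      (mul_pos hr (by linarith [hε.2])) (((ENNReal.ofReal_lt_ofReal_iff hr).2 h1).trans_le hrate)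
      hε.1 hε.2.le hs
    exact ⟨t, ht, _, sub_nonneg.2 hle, add_sub_cancel _ _⟩
  obtain ⟨_, ht, d, hd, hsum⟩ := hmem
  obtain ⟨k, K, rfl⟩ := exists_tension_eq_of_mem ht
  refine ⟨r⁻¹ • s, ⟨smul_nonneg (inv_nonneg.2 hr.le) hs.1, _, ⟨k, K, rfl⟩, ?_⟩,
    smul_inv_smul₀ hr.ne' s⟩
  rw [natTension_jointLaw] at hsum
  have : Real.log 2 • tension R K ≤ Real.log 2 • r⁻¹ • s := by
    rw [smul_smul, ← div_eq_mul_inv, ← hsum]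
    exact le_add_of_nonneg_right hd
  exact le_of_smul_le_smul_left this hlog
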